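/- **Setting.** For each $N\ge 1$ consider $N$ periodic cells, indexed by $j\in\mathbb Z/N\mathbb Z$, of size $h=1/N$, at $x_j=j/N$ (periodic with period 1). The state of a cell is $(z_j,\rho_j)\in\mathbb A=\{-1,1\}\times[0,\infty)$. The flow from cell $j$ to cell $j+1$ is $\Psi_{j+1/2}=\rho_j\max\{z_j,0\}+\rho_{j+1}\min\{z_{j+1},0\}$, and cell $j$ switches its direction $z_j$ at a measurable rate $\gamma_j=\gamma_j^N(\vec z,\vec\rho)\ge 0$. For $t>0$ let $\mathcal F^N(t)$ be a probability law on $\mathbb A^N$ with $\rho_j$ and $\gamma_j(1+\rho_j)$ integrable for all $j$, which satisfies the weak master equation $$\frac{d}{dt}\langle\mathcal F^N,\varphi\rangle=-\Big\langle\mathcal F^N,\sum_i(\Psi_{i+1/2}-\Psi_{i-1/2})\,\partial_{\rho_i}\varphi\Big\rangle+\frac1N\sum_i\big\langle\mathcal F^N,\gamma_i\,(\varphi(-z_i,\hat z_i,\vec\rho)-\varphi(\vec z,\vec\rho))\big\rangle$$ for all $t>0$ and all functions $\varphi=\psi(z_j,\rho_j)$ of the state of one cell, with $\psi(z,\cdot)\in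 C^1$ and $\partial_\rho\psi$ bounded. Let $\mathbf f^h(x_j,\cdot,\cdot,t)$ be the $j$-th one-cell marginal of $\mathcal F^N(t)$ and $\tilde{\mathbf f}^h(x_j,z,\rho,t)=\mathbf f^h(x_j,z,\rho,t/h)$. For a measure $\mathbf g$ on $\mathbb A$ put $p_\pm=\int\mathbf g(\pm1,d\rho)$, $\bar\rho_\pm=\int\rho\,\mathbf g(\pm1,d\rho)$, $\bar\rho=\bar\rho_++\bar\rho_-$ and $u=p_+-p_-$. Below, "locally uniformly" means: as $h\to0$, along all $x_j\to x\in\mathbb R$ and $t'\to t>0$. **Assumptions.** 1. (Propagation of chaos.) $\mathcal F^N(t)$ is the product of its one-cell marginals, for all $N$ and $t>0$. 2. (Smooth convergence.) There are measures $\tilde{\mathbf f}(x,\cdot,\cdot,t)$ on $\mathbb A$ with finite mass and finite first moment in $\rho$ such that $\langle\tilde{\mathbf f}^h(x_j,\cdot,\cdot,t'),\varphi\rangle\to\langle\tilde{\mathbf f}(x,\cdot,\cdot,t),\varphi\rangle$ locally uniformly for all continuous $\varphi$ on $\mathbb A$ of at most linear growth, and the difference quotients $\big(\bar\rho^h_\pm(x_{j+1},t')-\bar\rho^h_\pm(x_j,t')\big)/h$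 of the moments $\bar\rho^h_\pm$ of $\tilde{\mathbf f}^h$ converge locally uniformly. 3. (Mean-field limit for the rates.) For one-cell laws $\mathbf g^h(x_i,\cdot,\cdot,t)$ let $\bar\gamma^h[\mathbf g^h](x_j,z_j,\rho_j,t)=\big\langle\prod_{i\ne j}\mathbf g^h(x_i,z_i,\rho_i,t),\gamma_j\big\rangle$. There is $\bar\gamma$ such that $\bar\gamma^h[\tilde{\mathbf f}^h](x_j,z,\rho',t')\to\bar\gamma(x,z,\rho,t)$ locally uniformly and along all $\rho'\to\rho$; moreover near each $(x,t)$, $t>0$, for all small $h$, $\bar\gamma^h[\tilde{\mathbf f}^h](x_j,z,\rho,t')\le C(1+\rho)$ for all $z,\rho$, with $C$ independent of $h$. **Conclusion.** Let $p_\pm,\bar\rho,u$ be the moments of $\tilde{\mathbf f}$. For all $x\in\mathbb R$ and $t>0$, $$\tilde{\mathbf f}(x,\pm1,\rho,t)=p_\pm(x,t)\,\delta(\rho-\bar\rho(x,t)),\qquad p_\pm=\frac{1\pm u}2,$$ the derivatives $\partial_t\bar\rho$, $\partial_x(\bar\rho u)$, $\partial_tu$ exist, and $$\partial_t\bar\rho+\partial_x(\bar\rho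 u)=0,\qquad\partial_tu=\gamma_t\,(u_{\rm coll}-u),$$ where $\gamma_t=\tilde\gamma_-+\tilde\gamma_+$, $u_{\rm coll}=\dfrac{\tilde\gamma_--\tilde\gamma_+}{\tilde\gamma_-+\tilde\gamma_+}$ and $\tilde\gamma_\pm(x,t)=\bar\gamma(x,\pm1,\bar\rho(x,t),t)$ (the right-hand side of the equation for $u$ is read as $0$ where $\gamma_t=0$). If moreover the mean-field limit depends on the one-cell laws only through their limit, that is, if $\bar\gamma^h[\mathbf g^h]\to\bar\gamma$ in the sense of the first part of 3 for all one-cell probability laws $\mathbf g^h$ with finite first moments that converge to $\tilde{\mathbf f}$ in the sense of the first part of 2, then $\bar\gamma$ is also the limit of the effective rates of the limit laws: $\bar\gamma^h[\mathbf g^h]\to\bar\gamma$ in the same sense for $\mathbf g^h(x_i,z,\rho,t)=p_z(x_i,t)\,\delta(\rho-\bar\rho(x_i,t))$. -/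

import Mathlib

open MeasureTheory Filter Topology
open scoped NNReal

noncomputable section

namespace Sweeping

/-! ### The sweeping process on `N` periodic cells -/

/-- State `(z, ρ)` of one cell: direction `z ∈ {-1, 1}` and density `ρ ≥ 0`. -/
abbrev Cell : Type := ℤˣ × ℝ≥0

/-- State of all the cells; cells are indexed by `ℤ / N`, i.e. periodically. -/
abbrev Config (N : ℕ) : Type := ZMod N → Cell

/-- The direction `z = ±1` as a real number. -/
def dir (a : Cell) : ℝ := ((a.1 : ℤ) : ℝ)

/-- The density of a cell as a real number. -/
def dens (a : Cell) : ℝ := (a.2 : ℝ)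

/-- The flow `Ψ_{j+1/2}` from cell `j` to cell `j + 1`. -/
def flux {N : ℕ} (s : Config N) (j : ZMod N) : ℝ :=
  dens (s j) * max (dir (s j)) 0 + dens (s (j + 1)) * min (dir (s (j + 1))) 0

/-- The configuration in which the direction of cell `j` has been switched. -/
def switch {N : ℕ} (s : Config N) (j : ZMod N) : Config N :=
  Function.update s j (-(s j).1, (s j).2)

/-- Evaluation of a function of the directions and the densities at a configuration. -/
def evalAt {N : ℕ} (φ : (ZMod N → ℤˣ) → (ZMod N → ℝ) → ℝ) (s : Config N) : ℝ :=
  φ (fun k => (s k).1) (fun k => dens (s k))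

/-- The partial derivative `∂φ/∂ρ_i` at a configuration. -/
def partialDens {N : ℕ} (φ : (ZMod N → ℤˣ) → (ZMod N → ℝ) → ℝ) (i : ZMod N)
    (s : Config N) : ℝ :=
  deriv (fun r : ℝ => φ (fun k => (s k).1) (Function.update (fun k => dens (s k)) i r))
    (dens (s i))

/-- The Markov generator of the time-continuous sweeping process at the kinetic time scale:
`L φ = - ∑ i, (Ψ_{i+1/2} - Ψ_{i-1/2}) ∂φ/∂ρ_i + (1/N) ∑ i, γ_i (φ ∘ switch_i - φ)`. -/
def generator {N : ℕ} [NeZero N] (γ : ZMod N → Config N → ℝ)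
    (φ : (ZMod N → ℤˣ) → (ZMod N → ℝ) → ℝ) (s : Config N) : ℝ :=
  -(∑ i, (flux s i - flux s (i - 1)) * partialDens φ i s)
    + (1 / (N : ℝ)) * ∑ i, γ i s * (evalAt φ (switch s i) - evalAt φ s)

/-- One-cell test functions: `C¹` in the density with a bounded derivative. -/
def IsTest (ψ : ℤˣ → ℝ → ℝ) : Prop :=
  (∀ z, ContDiff ℝ 1 (ψ z)) ∧ ∃ C : ℝ, ∀ z r, |deriv (ψ z) r| ≤ C

/-- A function of the state of cell `j`, seen as a function of all cells. -/
def oneCell {N : ℕ} (j : ZMod N) (ψ : ℤˣ → ℝ → ℝ) :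
    (ZMod N → ℤˣ) → (ZMod N → ℝ) → ℝ :=
  fun z ρ => ψ (z j) (ρ j)

/-- The weak form `d/dt ⟨F, φ⟩ = ⟨F, L φ⟩` of the master equation at positive times, tested
against the functions `φ` of a single cell, together with the finiteness of the pairings that
occur in it. A law that satisfies the weak form for all test functions satisfies this; it is all
that enters the evolution of the one-cell marginals. (For test functions of several cells the
equation creates correlations between neighbours and would exclude most product laws.) -/
structure SolvesMasterEquation {N : ℕ} [NeZero N] (γ : ZMod N → Config N → ℝ)
    (F : ℝ → Measure (Config N)) : Prop where
  isProbabilityMeasure : ∀ t, 0 < t → IsProbabilityMeasure (F t)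
  integrable_dens : ∀ t, 0 < t → ∀ i, Integrable (fun s => dens (s i)) (F t)
  integrable_rate : ∀ t, 0 < t → ∀ i, Integrable (fun s => γ i s * (1 + dens (s i))) (F t)
  weak_form : ∀ t, 0 < t → ∀ (j : ZMod N) (ψ : ℤˣ → ℝ → ℝ), IsTest ψ →
    HasDerivAt (fun τ => ∫ s, evalAt (oneCell j ψ) s ∂(F τ))
      (∫ s, generator γ (oneCell j ψ) s ∂(F t)) t

/-- The one-cell marginal of the law of a configuration. -/
def marginal {N : ℕ} (μ : Measure (Config N)) (j : ZMod N) : Measure Cell :=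
  μ.map (fun s => s j)

/-- Propagation of chaos: the joint law is the product of its one-cell marginals. -/
def PropagationOfChaos {N : ℕ} [NeZero N] (F : ℝ → Measure (Config N)) : Prop :=
  ∀ t, 0 < t → F t = Measure.pi (fun j => marginal (F t) j)

/-- The effective rate `⟨∏_{i ≠ j} g_i, γ_j⟩` at the state `(z, ρ)` of cell `j`. The coordinate
`j` of the configuration is overwritten, so the probability measure `g_j` is integrated out. -/
def effRate {N : ℕ} [NeZero N] (γ : ZMod N → Config N → ℝ) (g : ZMod N → Measure Cell)
    (j : ZMod N) (z : ℤˣ) (ρ : ℝ≥0) : ℝ :=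
  ∫ s, γ j (Function.update s j (z, ρ)) ∂(Measure.pi g)

/-! ### Families indexed by the number of cells `N`, with cell size `h = 1 / N` -/

/-- One-cell laws `g N j t` for each number of cells `N`, cell `j` and macroscopic time `t`. -/
abbrev Profile : Type := (N : ℕ+) → ZMod N → ℝ → Measure Cell

/-- The one-cell marginals at the hydrodynamic time scale: time `t / h = N t`. -/
def rescaled (F : (N : ℕ+) → ℝ → Measure (Config N)) : Profile :=
  fun N j t => marginal (F N ((N : ℝ) * t)) j

/-- `N → ∞`, `x_j = j / N → x` and `t' → t`, for the triples `(N, j, t')`. -/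
def hydroFilter (x t : ℝ) : Filter (ℕ+ × ℤ × ℝ) :=
  comap (fun q => (q.1, (q.2.1 : ℝ) / (q.1 : ℝ), q.2.2)) (atTop ×ˢ 𝓝 x ×ˢ 𝓝 t)

/-- Convergence of functions on the space-time grid to a function of `(x, t)`, `t > 0`, along
all grid points and times that converge to `(x, t)` (locally uniform convergence). -/
def GridTendsto (a : (N : ℕ+) → ZMod N → ℝ → ℝ) (b : ℝ → ℝ → ℝ) : Prop :=
  ∀ x t, 0 < t →
    Tendsto (fun q : ℕ+ × ℤ × ℝ => a q.1 (q.2.1 : ZMod q.1) q.2.2) (hydroFilter x t) (𝓝 (b x t))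

/-- Convergence of one-cell laws to `f x t`, tested against continuous functions of at most
linear growth in the density: narrow convergence together with convergence of first moments. -/
structure ProfileTendsto (g : Profile) (f : ℝ → ℝ → Measure Cell) : Prop where
  integrable : ∀ x t, 0 < t → Integrable (fun a => 1 + dens a) (f x t)
  tendsto : ∀ φ : ℤˣ → ℝ≥0 → ℝ, (∀ z, Continuous (φ z)) →
    (∃ C : ℝ, ∀ z (ρ : ℝ≥0), |φ z ρ| ≤ C * (1 + (ρ : ℝ))) →
    GridTendsto (fun N j t => ∫ a, φ a.1 a.2 ∂(g N j t)) (fun x t => ∫ a, φ a.1 a.2 ∂(f x t))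

/-! ### Moments of one-cell laws -/

/-- The measure `μ(z, ·)` on the densities. -/
def component (μ : Measure Cell) (z : ℤˣ) : Measure ℝ≥0 :=
  (μ.restrict (Prod.fst ⁻¹' {z})).map Prod.snd

/-- `p_z = ∫ μ(z, dρ)`. -/
def prob (μ : Measure Cell) (z : ℤˣ) : ℝ := (component μ z).real Set.univ

/-- `ρ̄_z = ∫ ρ μ(z, dρ)`. -/
def meanDensOf (μ : Measure Cell) (z : ℤˣ) : ℝ := ∫ ρ : ℝ≥0, (ρ : ℝ) ∂(component μ z)

/-- `ρ̄ = ρ̄_+ + ρ̄_-`. -/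
def meanDens (μ : Measure Cell) : ℝ := meanDensOf μ 1 + meanDensOf μ (-1)

/-- `u = p_+ - p_-`. -/
def velocity (μ : Measure Cell) : ℝ := prob μ 1 - prob μ (-1)

/-- Smooth convergence of one-cell laws: `ProfileTendsto`, and the partial mean densities `ρ̄_±`
converge in `C¹` with respect to the space variable, i.e. their difference quotients converge. -/
structure SmoothTendsto (g : Profile) (f : ℝ → ℝ → Measure Cell) : Prop extends
    ProfileTendsto g f where
  space_deriv : ∀ z : ℤˣ, ∃ D : ℝ → ℝ → ℝ,
    GridTendsto
      (fun N j t => (meanDensOf (g N (j + 1) t) z - meanDensOf (g N j t) z) / (1 / (N : ℝ))) D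

/-! ### Mean-field limit of the rates -/

/-- `γ̄^h(x_j, z, ρ', t') → γ̄(x, z, ρ, t)` as `h → 0`, `x_j → x`, `ρ' → ρ`, `t' → t`, where
`γ̄^h` is the effective rate for the one-cell laws `g`. -/
def RateTendsto (γ : (N : ℕ+) → ZMod N → Config N → ℝ) (g : Profile)
    (γbar : ℝ → ℤˣ → ℝ≥0 → ℝ → ℝ) : Prop :=
  ∀ (x t : ℝ) (z : ℤˣ) (ρ : ℝ≥0), 0 < t →
    Tendsto
      (fun q : (ℕ+ × ℤ × ℝ) × ℝ≥0 =>
        effRate (γ q.1.1) (fun i => g q.1.1 i q.1.2.2) (q.1.2.1 : ZMod q.1.1) z q.2)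
      (hydroFilter x t ×ˢ 𝓝 ρ) (𝓝 (γbar x z ρ t))

/-- The mean-field limit for the rates: the effective rates converge, and, locally uniformly in
space and time, they grow at most linearly in the density. -/
structure MeanFieldLimit (γ : (N : ℕ+) → ZMod N → Config N → ℝ) (g : Profile)
    (γbar : ℝ → ℤˣ → ℝ≥0 → ℝ → ℝ) : Prop where
  tendsto : RateTendsto γ g γbar
  growth : ∀ x t, 0 < t → ∃ C : ℝ, ∀ᶠ q in hydroFilter x t, ∀ (z : ℤˣ) (ρ : ℝ≥0),
    effRate (γ q.1) (fun i => g q.1 i q.2.2) (q.2.1 : ZMod q.1) z ρ ≤ C * (1 + (ρ : ℝ))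

/-- The mean-field limit of the rates depends on the one-cell laws only through their limit `f`:
all one-cell laws that converge to `f` give the same limit of the effective rates. -/
def MeanFieldStable (γ : (N : ℕ+) → ZMod N → Config N → ℝ) (f : ℝ → ℝ → Measure Cell)
    (γbar : ℝ → ℤˣ → ℝ≥0 → ℝ → ℝ) : Prop :=
  ∀ g : Profile,
    (∀ N j t, 0 < t → IsProbabilityMeasure (g N j t) ∧ Integrable dens (g N j t)) →
    ProfileTendsto g f → RateTendsto γ g γbar

/-- The one-cell laws `p_z(x_i, t) δ(ρ - ρ̄(x_i, t))` on the grid `x_i = i / N`, with the moments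
`p_±`, `ρ̄` of `f`. -/
def diracProfile (f : ℝ → ℝ → Measure Cell) : Profile := fun N i t =>
  ∑ z : ℤˣ, ENNReal.ofReal (prob (f ((i.val : ℝ) / (N : ℝ)) t) z) •
    Measure.dirac (z, (meanDens (f ((i.val : ℝ) / (N : ℝ)) t)).toNNReal)

/-- `γ̃_±(x, t) = γ̄(x, ±1, ρ̄(x, t), t)`. -/
def limitRate (γbar : ℝ → ℤˣ → ℝ≥0 → ℝ → ℝ) (f : ℝ → ℝ → Measure Cell) (z : ℤˣ)
    (x t : ℝ) : ℝ :=
  γbar x z (meanDens (f x t)).toNNReal t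

/-- `γ_t = γ̃_- + γ̃_+`. -/
def totalRate (γbar : ℝ → ℤˣ → ℝ≥0 → ℝ → ℝ) (f : ℝ → ℝ → Measure Cell) (x t : ℝ) : ℝ :=
  limitRate γbar f (-1) x t + limitRate γbar f 1 x t

/-- `u_coll = (γ̃_- - γ̃_+) / (γ̃_- + γ̃_+)`; where both rates vanish the value is irrelevant, as
`u_coll` is only used multiplied by `γ_t`. -/
def collVelocity (γbar : ℝ → ℤˣ → ℝ≥0 → ℝ → ℝ) (f : ℝ → ℝ → Measure Cell) (x t : ℝ) : ℝ :=
  (limitRate γbar f (-1) x t - limitRate γbar f 1 x t) /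
    (limitRate γbar f (-1) x t + limitRate γbar f 1 x t)

end Sweeping

end

/-!
After rescaling time, the equation for the mean of a one-cell test function `ψ` contains the
transport term multiplied by `N` and the switching term without a large factor. If `ψ` depends on
the density only, there is no switching term, so the limit of the transport term vanishes:
`ρ̄ ⟨f, ψ'⟩ = ⟨f, ρ ψ'⟩`. The choice `ψ = log (1 + (ρ - ρ̄)²)`, whose derivative is bounded and has
the sign of `ρ - ρ̄`, then forces `f` to be concentrated at `ρ = ρ̄`. For `ψ = ρ` the transport term
is the difference of the flows between neighbouring cells, and `N` times it is a difference quotient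
that converges to `-∂ₓ(ρ̄₊ - ρ̄₋) = -∂ₓ(ρ̄ u)`. For `ψ = z` the transport term vanishes, and the
switching term converges to the relaxation term.
-/

noncomputable section

namespace Sweeping

section Tail

variable {X : Type*} {w : X → ℝ}

/-- The weight `w`, cut off continuously below the level `R`. It bounds what is left of a function
of growth `w` outside the sublevel set of `w` at the level `R + 1`. -/
def tail (w : X → ℝ) (R : ℝ) (x : X) : ℝ := w x * min 1 (max 0 (w x - R))

theorem tail_nonneg (hw : ∀ x, 0 ≤ w x) (R : ℝ) (x : X) : 0 ≤ tail w R x :=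
  mul_nonneg (hw x) (le_min zero_le_one (le_max_left _ _))

theorem tail_le (hw : ∀ x, 0 ≤ w x) (R : ℝ) (x : X) : tail w R x ≤ w x :=
  mul_le_of_le_one_right (hw x) (min_le_left _ _)

theorem tail_eq_zero {R : ℝ} {x : X} (h : w x ≤ R) : tail w R x = 0 := by
  simp [tail, max_eq_left (sub_nonpos.2 h)]

theorem tail_eq_self {R : ℝ} {x : X} (h : R + 1 ≤ w x) : tail w R x = w x := by
  simp [tail, le_max_of_le_right (show (1 : ℝ) ≤ w x - R by linarith)]

theorem integrable_of_abs_le_mul [MeasurableSpace X] {μ : Measure X} (hint : Integrable w μ)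
    {φ : X → ℝ} (hφ : AEStronglyMeasurable φ μ) {C : ℝ} (hC : ∀ x, |φ x| ≤ C * w x) :
    Integrable φ μ :=
  (hint.const_mul C).mono' hφ (Eventually.of_forall hC)

end Tail

section ContinuousConvergence

variable {ι X Y : Type*} [TopologicalSpace X]

theorem continuousAt_of_tendsto_inf_comap [TopologicalSpace Y] [RegularSpace Y] {L : Filter ι}
    {π : ι → X} {a : ι → Y} {b : X → Y} {x : X} (hne : ∀ y, (L ⊓ comap π (𝓝 y)).NeBot)
    (h : ∀ᶠ y in 𝓝 x, Tendsto a (L ⊓ comap π (𝓝 y)) (𝓝 (b y))) : ContinuousAt b x := by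
  refine (closed_nhds_basis (b x)).tendsto_right_iff.2 fun V ⟨hV, hVclosed⟩ => ?_
  obtain ⟨S, hS, T, ⟨U, hU, hUT⟩, hST⟩ := mem_inf_iff_superset.1 (h.self_of_nhds hV)
  filter_upwards [h, eventually_mem_nhds_iff.2 hU] with y hy hyU
  have := hne y
  refine hVclosed.mem_of_tendsto hy ?_
  filter_upwards [mem_inf_of_left hS, mem_inf_of_right (preimage_mem_comap hyU)] with i hiS hiU
  exact hST ⟨hiS, hUT hiU⟩

theorem continuous_of_tendsto_prod_nhds [TopologicalSpace Y] [RegularSpace Y] {l : Filter ι}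
    [l.NeBot] {E : ι → X → Y} {G : X → Y}
    (h : ∀ x, Tendsto (fun p : ι × X => E p.1 p.2) (l ×ˢ 𝓝 x) (𝓝 (G x))) : Continuous G :=
  continuous_iff_continuousAt.2 fun _ =>
    continuousAt_of_tendsto_inf_comap (L := comap Prod.fst l) (π := Prod.snd)
      (fun y => inferInstanceAs (l ×ˢ 𝓝 y).NeBot) (Eventually.of_forall h)

theorem tendstoLocallyUniformly_of_tendsto_prod_nhds [UniformSpace Y] {l : Filter ι} [l.NeBot]
    {E : ι → X → Y} {G : X → Y}
    (h : ∀ x, Tendsto (fun p : ι × X => E p.1 p.2) (l ×ˢ 𝓝 x) (𝓝 (G x))) :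
    TendstoLocallyUniformly E G l := by
  refine tendstoLocallyUniformly_iff_forall_tendsto.2 fun x => ?_
  have hG := (continuous_of_tendsto_prod_nhds h).tendsto x
  refine Tendsto.mono_right ?_ (nhds_le_uniformity (G x))
  rw [nhds_prod_eq]
  exact (hG.comp tendsto_snd).prodMk (h x)

variable {w : X → ℝ}

theorem continuous_tail (hw : Continuous w) (R : ℝ) : Continuous (tail w R) := by
  unfold tail
  fun_prop

theorem eventually_abs_sub_le_tail {l : Filter ι} [l.NeBot] {E : ι → X → ℝ} {G : X → ℝ} {C : ℝ}
    (hw1 : ∀ x, 1 ≤ w x) (hcpt : ∀ R, IsCompact {x | w x ≤ R})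
    (hE : ∀ᶠ i in l, ∀ x, |E i x| ≤ C * w x) (hG : ∀ x, |G x| ≤ C * w x)
    (h : ∀ x, Tendsto (fun p : ι × X => E p.1 p.2) (l ×ˢ 𝓝 x) (𝓝 (G x))) {R : ℝ} (hR : 0 < R) :
    ∀ᶠ i in l, ∀ x, |E i x - G x| ≤ w x / R + 2 * C * tail w R x := by
  have hw0 : ∀ x, 0 < w x := fun x => one_pos.trans_le (hw1 x)
  have huniform := (tendstoLocallyUniformlyOn_iff_tendstoUniformlyOn_of_compact
    (hcpt (R + 1))).1 (tendstoLocallyUniformly_of_tendsto_prod_nhds h).tendstoLocallyUniformlyOn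
  filter_upwards [hE, Metric.tendstoUniformlyOn_iff.1 huniform (1 / R) (by positivity)]
    with i hEi hi x
  rcases le_total (w x) (R + 1) with hx | hx
  · have hC : 0 ≤ C := nonneg_of_mul_nonneg_left ((abs_nonneg _).trans (hG x)) (hw0 x)
    have htail : 0 ≤ 2 * C * tail w R x :=
      mul_nonneg (by positivity) (tail_nonneg (fun y => (hw0 y).le) R x)
    calc |E i x - G x| = dist (G x) (E i x) := by rw [dist_comm, Real.dist_eq]
      _ ≤ 1 / R := (hi x hx).le
      _ ≤ w x / R := by gcongr; exact hw1 x
      _ ≤ w x / R + 2 * C * tail w R x := le_add_of_nonneg_right htail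
  · calc |E i x - G x| ≤ |E i x| + |G x| := abs_sub _ _
      _ ≤ 2 * C * w x := by linarith [hEi x, hG x]
      _ ≤ w x / R + 2 * C * tail w R x := by
        rw [tail_eq_self hx]
        exact le_add_of_nonneg_left (div_nonneg (hw0 x).le hR.le)

variable [MeasurableSpace X] [OpensMeasurableSpace X] {μ : Measure X}

theorem tendsto_integral_tail (hw : Continuous w) (hw0 : ∀ x, 0 ≤ w x) (hint : Integrable w μ) :
    Tendsto (fun R => ∫ x, tail w R x ∂μ) atTop (𝓝 0) := by
  rw [← integral_zero X ℝ (μ := μ)]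
  refine tendsto_integral_filter_of_dominated_convergence w
    (Eventually.of_forall fun R => (continuous_tail hw R).aestronglyMeasurable)
    (Eventually.of_forall fun R => Eventually.of_forall fun x => ?_) hint
    (Eventually.of_forall fun x => ?_)
  · rw [Real.norm_of_nonneg (tail_nonneg hw0 R x)]
    exact tail_le hw0 R x
  · refine tendsto_const_nhds.congr' ?_
    filter_upwards [eventually_ge_atTop (w x)] with R hR using (tail_eq_zero hR).symm

theorem tendsto_integral_envelope (hw : Continuous w) (hw0 : ∀ x, 0 ≤ w x)
    (hint : Integrable w μ) (C : ℝ) :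
    Tendsto (fun R => ∫ x, (w x / R + C * tail w R x) ∂μ) atTop (𝓝 0) := by
  have htail : ∀ R, Integrable (tail w R) μ := fun R =>
    integrable_of_abs_le_mul hint (continuous_tail hw R).aestronglyMeasurable (C := 1) fun x => by
      rw [abs_of_nonneg (tail_nonneg hw0 R x), one_mul]
      exact tail_le hw0 R x
  have hsplit : ∀ R, ∫ x, (w x / R + C * tail w R x) ∂μ
      = (∫ x, w x ∂μ) / R + C * ∫ x, tail w R x ∂μ := fun R => by
    rw [integral_add (hint.div_const R) ((htail R).const_mul C), integral_div, integral_const_mul]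
  simp only [hsplit]
  simpa using (tendsto_id.const_div_atTop (∫ x, w x ∂μ)).add
    ((tendsto_integral_tail hw hw0 hint).const_mul C)

/-- The integrands converge uniformly on the sublevel sets of `w`; the rest is controlled by `tail`,
which is itself an admissible test function for the weak convergence of the measures. -/
theorem tendsto_integral_of_tendsto_prod_nhds {l : Filter ι} [l.NeBot] {ν : ι → Measure X}
    {E : ι → X → ℝ} {G : X → ℝ} {C : ℝ} (hw : Continuous w) (hw1 : ∀ x, 1 ≤ w x)
    (hcpt : ∀ R, IsCompact {x | w x ≤ R}) (hμ : Integrable w μ)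
    (hν : ∀ᶠ i in l, Integrable w (ν i))
    (hweak : ∀ φ : X → ℝ, Continuous φ → (∃ C, ∀ x, |φ x| ≤ C * w x) →
      Tendsto (fun i => ∫ x, φ x ∂(ν i)) l (𝓝 (∫ x, φ x ∂μ)))
    (hEmeas : ∀ᶠ i in l, AEStronglyMeasurable (E i) (ν i))
    (hE : ∀ᶠ i in l, ∀ x, |E i x| ≤ C * w x)
    (h : ∀ x, Tendsto (fun p : ι × X => E p.1 p.2) (l ×ˢ 𝓝 x) (𝓝 (G x))) :
    Tendsto (fun i => ∫ x, E i x ∂(ν i)) l (𝓝 (∫ x, G x ∂μ)) := by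
  have hw0 : ∀ x, 0 ≤ w x := fun x => zero_le_one.trans (hw1 x)
  have hGcont : Continuous G := continuous_of_tendsto_prod_nhds h
  have hG : ∀ x, |G x| ≤ C * w x := fun x =>
    le_of_tendsto ((h x).comp (tendsto_id.prodMk (tendsto_const_nhds (x := x)))).abs
      (hE.mono fun i hi => hi x)
  refine (hweak G hGcont ⟨C, hG⟩).congr_dist (Metric.tendsto_nhds.2 fun ε hε => ?_)
  obtain ⟨R, hRε, hR⟩ := (((tendsto_integral_envelope hw hw0 hμ (2 * C)).eventually
    (gt_mem_nhds hε)).and (eventually_gt_atTop 0)).exists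
  set K : X → ℝ := fun x => w x / R + 2 * C * tail w R x
  have hKcont : Continuous K := (hw.div_const R).add ((continuous_tail hw R).const_mul _)
  have hKle : ∀ x, |K x| ≤ (1 / R + |2 * C|) * w x := fun x => by
    calc |K x| ≤ |w x / R| + |2 * C * tail w R x| := abs_add_le _ _
      _ = w x / R + |2 * C| * tail w R x := by
        rw [abs_mul, abs_of_nonneg (div_nonneg (hw0 x) hR.le), abs_of_nonneg (tail_nonneg hw0 R x)]
      _ ≤ w x / R + |2 * C| * w x := by gcongr; exact tail_le hw0 R x
      _ = (1 / R + |2 * C|) * w x := by ring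
  filter_upwards [hν, hEmeas, hE, eventually_abs_sub_le_tail hw1 hcpt hE hG h hR,
    (hweak K hKcont ⟨_, hKle⟩).eventually (gt_mem_nhds hRε)] with i hνi hEm hEi hEK hKi
  have hGi := integrable_of_abs_le_mul hνi hGcont.aestronglyMeasurable hG
  have hKint := integrable_of_abs_le_mul hνi hKcont.aestronglyMeasurable hKle
  have hle : ‖∫ x, (E i x - G x) ∂(ν i)‖ ≤ ∫ x, K x ∂(ν i) :=
    norm_integral_le_of_norm_le hKint (Eventually.of_forall hEK)
  rw [integral_sub (integrable_of_abs_le_mul hνi hEm hEi) hGi, ← dist_eq_norm] at hle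
  rw [dist_zero_right, Real.norm_of_nonneg dist_nonneg, dist_comm]
  exact hle.trans_lt hKi

end ContinuousConvergence

section HydroFilter

theorem pnat_cast_pos (N : ℕ+) : (0 : ℝ) < (N : ℝ) := Nat.cast_pos.2 N.pos

theorem tendsto_pnat_cast : Tendsto (fun N : ℕ+ => (N : ℝ)) atTop atTop :=
  tendsto_natCast_atTop_atTop.comp tendsto_PNat_val_atTop_atTop

theorem tendsto_floor_mul_div (x : ℝ) :
    Tendsto (fun N : ℕ+ => ((⌊x * (N : ℝ)⌋ : ℤ) : ℝ) / (N : ℝ)) atTop (𝓝 x) := by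
  have hlow : Tendsto (fun N : ℕ+ => x - 1 / (N : ℝ)) atTop (𝓝 x) := by
    simpa using (tendsto_pnat_cast.const_div_atTop 1).const_sub x
  refine tendsto_of_tendsto_of_tendsto_of_le_of_le hlow tendsto_const_nhds (fun N => ?_)
    fun N => (div_le_iff₀ (pnat_cast_pos N)).2 (Int.floor_le _)
  simp only [le_div_iff₀ (pnat_cast_pos N), sub_mul, one_div_mul_cancel (pnat_cast_pos N).ne']
  exact (Int.sub_one_lt_floor _).le

variable {x t : ℝ}

theorem tendsto_hydroFilter_iff {ι : Type*} {l : Filter ι} {q : ι → ℕ+ × ℤ × ℝ} :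
    Tendsto q l (hydroFilter x t) ↔ Tendsto (fun i => (q i).1) l atTop ∧
      Tendsto (fun i => ((q i).2.1 : ℝ) / ((q i).1 : ℝ)) l (𝓝 x) ∧
      Tendsto (fun i => (q i).2.2) l (𝓝 t) := by
  rw [hydroFilter, tendsto_comap_iff, tendsto_prod_iff', tendsto_prod_iff']
  rfl

theorem tendsto_cells_hydroFilter :
    Tendsto (fun q : ℕ+ × ℤ × ℝ => q.1) (hydroFilter x t) atTop :=
  (tendsto_hydroFilter_iff.1 tendsto_id).1

theorem tendsto_pos_hydroFilter :
    Tendsto (fun q : ℕ+ × ℤ × ℝ => (q.2.1 : ℝ) / (q.1 : ℝ)) (hydroFilter x t) (𝓝 x) :=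
  (tendsto_hydroFilter_iff.1 tendsto_id).2.1

theorem tendsto_time_hydroFilter :
    Tendsto (fun q : ℕ+ × ℤ × ℝ => q.2.2) (hydroFilter x t) (𝓝 t) :=
  (tendsto_hydroFilter_iff.1 tendsto_id).2.2

theorem hydroFilter_eq_inf_comap :
    hydroFilter x t = comap Prod.fst atTop ⊓
      comap (fun q : ℕ+ × ℤ × ℝ => ((q.2.1 : ℝ) / (q.1 : ℝ), q.2.2)) (𝓝 (x, t)) := by
  simp only [hydroFilter, nhds_prod_eq, prod_eq_inf, comap_inf, comap_comap, Function.comp_def]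

theorem exists_pos_of_eventually_hydroFilter {P : ℕ+ × ℤ × ℝ → Prop}
    (h : ∀ᶠ q in hydroFilter x t, P q) :
    ∃ δ > 0, ∀ᶠ N : ℕ+ in atTop, ∀ j : ℤ, |(j : ℝ) / (N : ℝ) - x| < δ → P (N, j, t) := by
  rw [hydroFilter_eq_inf_comap, Filter.Eventually, mem_inf_iff_superset] at h
  obtain ⟨S, ⟨T, hT, hTS⟩, S', ⟨U, hU, hUS⟩, hP⟩ := h
  obtain ⟨δ, hδ, hball⟩ := Metric.mem_nhds_iff.1 hU
  refine ⟨δ, hδ, mem_of_superset hT fun N hN j hj => hP ⟨hTS hN, hUS (hball ?_)⟩⟩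
  simpa [Prod.dist_eq, Real.dist_eq, hδ] using hj

theorem tendsto_floor_hydroFilter {ι : Type*} {l : Filter ι} {N : ι → ℕ+} {s : ι → ℝ} (x : ℝ)
    {t : ℝ} (hN : Tendsto N l atTop) (hs : Tendsto s l (𝓝 t)) :
    Tendsto (fun i => (N i, ⌊x * (N i : ℝ)⌋, s i)) l (hydroFilter x t) :=
  tendsto_hydroFilter_iff.2 ⟨hN, (tendsto_floor_mul_div x).comp hN, hs⟩

instance hydroFilter_neBot (x t : ℝ) : (hydroFilter x t).NeBot :=
  (tendsto_floor_hydroFilter x (tendsto_id (α := ℕ+) (x := atTop))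
    (tendsto_const_nhds (x := t))).neBot

theorem tendsto_add_hydroFilter (m : ℤ) :
    Tendsto (fun q : ℕ+ × ℤ × ℝ => (q.1, q.2.1 + m, q.2.2)) (hydroFilter x t)
      (hydroFilter x t) := by
  refine tendsto_hydroFilter_iff.2 ⟨tendsto_cells_hydroFilter, ?_, tendsto_time_hydroFilter⟩
  simpa [add_div] using (tendsto_pos_hydroFilter (x := x) (t := t)).add
    ((tendsto_pnat_cast.comp tendsto_cells_hydroFilter).const_div_atTop (m : ℝ))

theorem tendsto_period_hydroFilter :
    Tendsto (fun q : ℕ+ × ℤ × ℝ => (q.1, q.2.1 + (q.1 : ℕ), q.2.2)) (hydroFilter x t)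
      (hydroFilter (x + 1) t) := by
  refine tendsto_hydroFilter_iff.2 ⟨tendsto_cells_hydroFilter, ?_, tendsto_time_hydroFilter⟩
  refine (tendsto_pos_hydroFilter.add_const 1).congr fun q => ?_
  have := (pnat_cast_pos q.1).ne'
  push_cast
  field_simp

theorem eventually_time_pos (x : ℝ) (ht : 0 < t) : ∀ᶠ q in hydroFilter x t, 0 < q.2.2 :=
  tendsto_time_hydroFilter.eventually (lt_mem_nhds ht)

end HydroFilter

section GridTendsto

variable {a a' : (N : ℕ+) → ZMod N → ℝ → ℝ} {b c : ℝ → ℝ → ℝ} {x t : ℝ}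

theorem GridTendsto.comp_shift (h : GridTendsto a b) (m : ℤ) :
    GridTendsto (fun N j t => a N (j + m) t) b := by
  intro x t ht
  simpa [Function.comp_def] using (h x t ht).comp (tendsto_add_hydroFilter m)

theorem GridTendsto.periodic (h : GridTendsto a b) (ht : 0 < t) :
    Function.Periodic (fun x => b x t) 1 := by
  intro x
  refine tendsto_nhds_unique (((h (x + 1) t ht).comp tendsto_period_hydroFilter).congr ?_)
    (h x t ht)
  simp

theorem GridTendsto.tendsto_floor (h : GridTendsto a b) (x : ℝ) (ht : 0 < t) :
    Tendsto (fun N : ℕ+ => a N (⌊x * (N : ℝ)⌋ : ℤ) t) atTop (𝓝 (b x t)) :=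
  (h x t ht).comp (tendsto_floor_hydroFilter x tendsto_id tendsto_const_nhds)

theorem GridTendsto.continuousAt (h : GridTendsto a b) (x : ℝ) (ht : 0 < t) :
    ContinuousAt (fun p : ℝ × ℝ => b p.1 p.2) (x, t) := by
  refine continuousAt_of_tendsto_inf_comap (L := comap Prod.fst atTop)
    (π := fun q : ℕ+ × ℤ × ℝ => ((q.2.1 : ℝ) / (q.1 : ℝ), q.2.2))
    (a := fun q => a q.1 (q.2.1 : ZMod q.1) q.2.2)
    (fun p => hydroFilter_eq_inf_comap ▸ hydroFilter_neBot p.1 p.2) ?_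
  filter_upwards [continuous_snd.continuousAt.eventually (lt_mem_nhds ht)] with p hp
  exact hydroFilter_eq_inf_comap ▸ h p.1 p.2 hp

theorem GridTendsto.hasDerivAt_time (h : GridTendsto a b) (h' : GridTendsto a' c)
    (hd : ∀ᶠ N : ℕ+ in atTop, ∀ j t, 0 < t → HasDerivAt (a N j) (a' N j t) t) (x : ℝ)
    (ht : 0 < t) : HasDerivAt (b x) (c x t) t := by
  refine hasDerivAt_of_tendstoLocallyUniformlyOn (l := atTop) (s := Set.Ioi (0 : ℝ))
    (f := fun N => a N (⌊x * (N : ℝ)⌋ : ℤ)) (f' := fun N => a' N (⌊x * (N : ℝ)⌋ : ℤ))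
    isOpen_Ioi ?_ (hd.mono fun N hN s hs => hN _ s hs) (fun s hs => h.tendsto_floor x hs) ht
  rw [tendstoLocallyUniformlyOn_iff_filter]
  intro s hs
  have hsnd : Tendsto (fun p : ℕ+ × ℝ => p.2) (atTop ×ˢ 𝓝[Set.Ioi 0] s) (𝓝 s) :=
    tendsto_snd.mono_right nhdsWithin_le_nhds
  rw [tendstoUniformlyOnFilter_iff_tendsto]
  refine Tendsto.mono_right ?_ (nhds_le_uniformity (c x s))
  rw [nhds_prod_eq]
  exact ((h'.continuousAt x hs).tendsto.comp (tendsto_const_nhds.prodMk_nhds hsnd)).prodMk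
    ((h' x s hs).comp (tendsto_floor_hydroFilter x tendsto_fst hsnd))

/-- Divided by the number of cells, the grid functions tend to zero, so the limit of the
derivatives is the derivative of zero. -/
theorem GridTendsto.eq_zero_of_hasDerivAt_mul (h : GridTendsto a b) (h' : GridTendsto a' c)
    (hd : ∀ᶠ N : ℕ+ in atTop, ∀ j t, 0 < t → HasDerivAt (a N j) ((N : ℝ) * a' N j t) t) (x : ℝ)
    (ht : 0 < t) : c x t = 0 := by
  have hzero : GridTendsto (fun N j t => a N j t / (N : ℝ)) fun _ _ => 0 := fun x t ht =>
    (h x t ht).div_atTop (tendsto_pnat_cast.comp tendsto_cells_hydroFilter)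
  refine (hzero.hasDerivAt_time h' (hd.mono fun N hN j t ht => ?_) x ht).unique
    (hasDerivAt_const t 0)
  simpa [mul_div_cancel_left₀ _ (pnat_cast_pos N).ne'] using (hN j t ht).div_const (N : ℝ)

theorem abs_sub_sub_mul_le_of_abs_slope_sub_le {A : ℤ → ℝ} {h d ε : ℝ} (hh : 0 < h) {k m : ℤ}
    (hkm : k ≤ m) (hA : ∀ i, k ≤ i → i < m → |(A (i + 1) - A i) / h - d| ≤ ε) :
    |A m - A k - d * ((m - k) * h)| ≤ ε * ((m - k) * h) := by
  induction m, hkm using Int.leInduction with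
  | base => simp
  | succ m hkm ih =>
    have hih := ih fun i hki him => hA i hki (him.trans (lt_add_one m))
    have hstep : |A (m + 1) - A m - d * h| ≤ ε * h := by
      have := hA m hkm (lt_add_one m)
      rwa [div_sub' hh.ne', abs_div, abs_of_pos hh, div_le_iff₀ hh, mul_comm h d] at this
    push_cast
    calc |A (m + 1) - A k - d * ((m + 1 - k) * h)|
        = |(A (m + 1) - A m - d * h) + (A m - A k - d * ((m - k) * h))| := by ring_nf
      _ ≤ ε * h + ε * ((m - k) * h) := (abs_add_le _ _).trans (add_le_add hstep hih)
      _ = ε * ((m + 1 - k) * h) := by ring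

variable {D : ℝ → ℝ → ℝ}

theorem GridTendsto.exists_abs_sub_sub_mul_le (h : GridTendsto a b)
    (h' : GridTendsto (fun N j t => (a N (j + 1) t - a N j t) / (1 / (N : ℝ))) D) (x : ℝ)
    (ht : 0 < t) {ε : ℝ} (hε : 0 < ε) :
    ∃ δ > 0, ∀ y y', |y - x| < δ → |y' - x| < δ → y ≤ y' →
      |b y' t - b y t - D x t * (y' - y)| ≤ ε * (y' - y) := by
  obtain ⟨δ, hδ, hslope⟩ := exists_pos_of_eventually_hydroFilter
    (Metric.tendsto_nhds.1 (h' x t ht) ε hε)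
  refine ⟨δ, hδ, fun y y' hy hy' hyy' => ?_⟩
  have hdiff := (tendsto_floor_mul_div y').sub (tendsto_floor_mul_div y)
  refine le_of_tendsto_of_tendsto
    (((h.tendsto_floor y' ht).sub (h.tendsto_floor y ht)).sub (hdiff.const_mul (D x t))).abs
    (hdiff.const_mul ε) ?_
  have hnear : ∀ {z : ℝ}, |z - x| < δ →
      ∀ᶠ N : ℕ+ in atTop, |((⌊z * (N : ℝ)⌋ : ℤ) : ℝ) / (N : ℝ) - x| < δ := fun hz =>
    ((tendsto_floor_mul_div _).sub_const x).abs.eventually (gt_mem_nhds hz)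
  filter_upwards [hslope, hnear hy, hnear hy'] with N hN hfloor hfloor'
  have hNpos := pnat_cast_pos N
  have hmean := abs_sub_sub_mul_le_of_abs_slope_sub_le (A := fun i => a N (i : ZMod N) t)
    (h := 1 / (N : ℝ)) (d := D x t) (ε := ε) (by positivity)
    (Int.floor_le_floor (show y * (N : ℝ) ≤ y' * (N : ℝ) by gcongr)) fun i hi hi' => by
      have hlow : ((⌊y * (N : ℝ)⌋ : ℤ) : ℝ) / (N : ℝ) ≤ (i : ℝ) / (N : ℝ) := by gcongr
      have hupp : (i : ℝ) / (N : ℝ) ≤ ((⌊y' * (N : ℝ)⌋ : ℤ) : ℝ) / (N : ℝ) := by gcongr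
      rw [abs_lt] at hfloor hfloor'
      have := (hN i (abs_lt.2 ⟨by linarith, by linarith⟩)).le
      simpa [Real.dist_eq] using this
  simpa only [mul_one_div, sub_div] using hmean

theorem GridTendsto.hasDerivAt_space (h : GridTendsto a b)
    (h' : GridTendsto (fun N j t => (a N (j + 1) t - a N j t) / (1 / (N : ℝ))) D) (x : ℝ)
    (ht : 0 < t) : HasDerivAt (fun y => b y t) (D x t) x := by
  rw [hasDerivAt_iff_isLittleO, Asymptotics.isLittleO_iff]
  intro ε hε
  obtain ⟨δ, hδ, hle⟩ := h.exists_abs_sub_sub_mul_le h' x ht hε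
  have hx : |x - x| < δ := by simpa using hδ
  filter_upwards [Metric.ball_mem_nhds x hδ] with y hy
  simp only [smul_eq_mul, Real.norm_eq_abs]
  rcases le_total x y with hxy | hyx
  · rw [abs_of_nonneg (sub_nonneg.2 hxy), mul_comm (y - x)]
    exact hle x y hx hy hxy
  · rw [abs_sub_comm y x, abs_of_nonneg (sub_nonneg.2 hyx), abs_sub_comm]
    convert hle y x hy hx hyx using 2
    ring

end GridTendsto

section ProductLaw

theorem map_update_pi {ι : Type*} [Fintype ι] [DecidableEq ι] {X : ι → Type*}
    [∀ i, MeasurableSpace (X i)] (g : (i : ι) → Measure (X i)) [∀ i, IsProbabilityMeasure (g i)]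
    (j : ι) :
    ((Measure.pi g).prod (g j)).map (fun p => Function.update p.1 j p.2) = Measure.pi g := by
  refine (Measure.pi_eq fun B hB => ?_).symm
  have hpreimage : (fun p : ((i : ι) → X i) × X j => Function.update p.1 j p.2) ⁻¹'
      Set.univ.pi B = Set.univ.pi (Function.update B j Set.univ) ×ˢ B j := by
    ext p
    simp only [Set.mem_preimage, Set.mem_prod, Set.mem_univ_pi,
      Function.forall_update_iff p.1 (fun i r => r ∈ B i),
      Function.forall_update_iff B (fun i S => p.1 i ∈ S), Set.mem_univ, true_and, and_comm]
  have hmass : (fun i => g i (Function.update B j Set.univ i))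
      = Function.update (fun i => g i (B i)) j 1 := by
    funext i
    rw [Function.apply_update (fun i => g i), measure_univ]
  rw [Measure.map_apply measurable_update' (MeasurableSet.univ_pi hB), hpreimage,
    Measure.prod_prod, Measure.pi_pi, hmass, Finset.prod_update_of_mem (Finset.mem_univ j), one_mul,
    Finset.sdiff_singleton_eq_erase, Finset.prod_erase_mul _ _ (Finset.mem_univ j)]

theorem integral_eval_mul_eval_pi {ι : Type*} [Fintype ι] {X : ι → Type*}
    [∀ i, MeasurableSpace (X i)] (g : (i : ι) → Measure (X i)) [∀ i, IsProbabilityMeasure (g i)]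
    {i j : ι} (hij : i ≠ j) {φ : X i → ℝ} {χ : X j → ℝ} (hφ : Measurable φ) (hχ : Measurable χ) :
    ∫ s, φ (s i) * χ (s j) ∂(Measure.pi g) = (∫ a, φ a ∂(g i)) * ∫ a, χ a ∂(g j) := by
  have hindep := (ProbabilityTheory.iIndepFun_pi (μ := g) (X := fun _ a => a)
    fun i => aemeasurable_id).indepFun hij
  rw [← integral_comp_eval (μ := g) hφ.aestronglyMeasurable,
    ← integral_comp_eval (μ := g) hχ.aestronglyMeasurable]
  exact (hindep.comp hφ hχ).integral_fun_mul_eq_mul_integral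
    (hφ.comp (measurable_pi_apply i)).aestronglyMeasurable
    (hχ.comp (measurable_pi_apply j)).aestronglyMeasurable

end ProductLaw

section CellLaw

instance measurableSingletonClass_units {M : Type*} [Monoid M] [MeasurableSpace M]
    [MeasurableSingletonClass M] : MeasurableSingletonClass Mˣ where
  measurableSet_singleton u :=
    ⟨{(u : M)}, measurableSet_singleton _, by ext v; simp [Units.ext_iff]⟩

theorem continuous_cell {φ : Cell → ℝ} (h : ∀ z, Continuous fun ρ : ℝ≥0 => φ (z, ρ)) :
    Continuous φ :=
  continuous_prod_of_discrete_left.2 h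

theorem continuous_dens : Continuous dens := NNReal.continuous_coe.comp continuous_snd

theorem measurable_dens : Measurable dens := continuous_dens.measurable

theorem dens_nonneg (a : Cell) : 0 ≤ dens a := a.2.2

theorem abs_dir (a : Cell) : |dir a| = 1 := by
  rcases Int.units_eq_one_or a.1 with h | h <;> simp [dir, h]

theorem isCompact_one_add_dens_le (R : ℝ) : IsCompact {a : Cell | 1 + dens a ≤ R} := by
  refine (isCompact_univ.prod (isCompact_Icc (a := (0 : ℝ≥0)) (b := R.toNNReal))).of_isClosed_subset
    (isClosed_le (continuous_const.add continuous_dens) continuous_const) fun a ha => ?_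
  refine ⟨Set.mem_univ _, bot_le, NNReal.le_toNNReal_of_coe_le ?_⟩
  linarith [ha.out, show dens a = a.2 from rfl]

/-- The density of a cell with direction `z`, and zero for the other direction: the integrand of
`meanDensOf · z`. -/
def densOf (z : ℤˣ) (a : Cell) : ℝ := if a.1 = z then dens a else 0

theorem continuous_densOf (z : ℤˣ) : Continuous (densOf z) :=
  continuous_cell fun w => by
    by_cases h : w = z
    · simpa [densOf, h, dens] using NNReal.continuous_coe
    · simpa [densOf, h] using continuous_const

theorem measurable_densOf (z : ℤˣ) : Measurable (densOf z) := (continuous_densOf z).measurable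

theorem abs_densOf_le (z : ℤˣ) (a : Cell) : |densOf z a| ≤ dens a := by
  unfold densOf
  split_ifs
  · exact (abs_of_nonneg (dens_nonneg a)).le
  · simpa using dens_nonneg a

theorem densOf_add_densOf (a : Cell) : densOf 1 a + densOf (-1) a = dens a := by
  rcases Int.units_eq_one_or a.1 with h | h <;> simp [densOf, h]

theorem measurableSet_fst_preimage (z : ℤˣ) : MeasurableSet (Prod.fst ⁻¹' {z} : Set Cell) :=
  measurable_fst (measurableSet_singleton z)

variable {μ : Measure Cell}

theorem integrable_densOf (hμ : Integrable dens μ) (z : ℤˣ) : Integrable (densOf z) μ :=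
  hμ.mono' (measurable_densOf z).aestronglyMeasurable (Eventually.of_forall (abs_densOf_le z))

theorem integrable_one_add_dens [IsFiniteMeasure μ] (hμ : Integrable dens μ) :
    Integrable (fun a => 1 + dens a) μ :=
  (integrable_const 1).add hμ

theorem integrable_dens_of_one_add (hμ : Integrable (fun a => 1 + dens a) μ) :
    Integrable dens μ :=
  integrable_of_abs_le_mul hμ measurable_dens.aestronglyMeasurable (C := 1) fun a => by
    rw [abs_of_nonneg (dens_nonneg a)]
    linarith

theorem isFiniteMeasure_of_integrable_one_add_dens (hμ : Integrable (fun a => 1 + dens a) μ) :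
    IsFiniteMeasure μ := by
  have h : Integrable (fun _ : Cell => (1 : ℝ)) μ :=
    integrable_of_abs_le_mul hμ aestronglyMeasurable_const (C := 1) fun a => by
      simpa using dens_nonneg a
  simpa using integrable_const_iff.1 h

theorem prob_eq_measureReal (μ : Measure Cell) (z : ℤˣ) :
    prob μ z = μ.real (Prod.fst ⁻¹' {z}) := by
  rw [prob, component, measureReal_def, Measure.map_apply measurable_snd MeasurableSet.univ]
  simp [measureReal_def]

theorem prob_nonneg (μ : Measure Cell) (z : ℤˣ) : 0 ≤ prob μ z := measureReal_nonneg

theorem sum_prob (μ : Measure Cell) [IsProbabilityMeasure μ] : prob μ 1 + prob μ (-1) = 1 := by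
  have hcompl : (Prod.fst ⁻¹' {(-1 : ℤˣ)} : Set Cell) = (Prod.fst ⁻¹' {(1 : ℤˣ)})ᶜ := by
    ext a
    rcases Int.units_eq_one_or a.1 with h | h <;> simp [h]
  rw [prob_eq_measureReal, prob_eq_measureReal, hcompl,
    probReal_add_probReal_compl (measurableSet_fst_preimage 1)]

theorem sum_intUnits {β : Type*} [AddCommMonoid β] (φ : ℤˣ → β) :
    ∑ z : ℤˣ, φ z = φ 1 + φ (-1) :=
  Finset.sum_pair (by decide)

theorem integral_fst_eq_sum_prob (μ : Measure Cell) [IsFiniteMeasure μ] (κ : ℤˣ → ℝ) :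
    ∫ a, κ a.1 ∂μ = ∑ z, prob μ z * κ z := by
  have hmap : ∫ a, κ a.1 ∂μ = ∫ z, κ z ∂(μ.map Prod.fst) :=
    (integral_map measurable_fst.aemeasurable .of_discrete).symm
  rw [hmap, integral_fintype .of_finite]
  simp only [prob_eq_measureReal, smul_eq_mul,
    map_measureReal_apply measurable_fst (measurableSet_singleton _)]

theorem velocity_eq_integral (μ : Measure Cell) [IsFiniteMeasure μ] :
    velocity μ = ∫ a, dir a ∂μ := by
  rw [velocity, show ∫ a, dir a ∂μ = _ from integral_fst_eq_sum_prob μ fun z => ((z : ℤ) : ℝ),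
    sum_intUnits]
  simp [sub_eq_add_neg]

theorem meanDensOf_eq_integral (μ : Measure Cell) (z : ℤˣ) :
    meanDensOf μ z = ∫ a, densOf z a ∂μ := by
  rw [meanDensOf, component, integral_map measurable_snd.aemeasurable
    measurable_coe_nnreal_real.aestronglyMeasurable,
    ← integral_indicator (measurableSet_fst_preimage z)]
  congr with a
  by_cases h : a.1 = z <;> simp [h, densOf, dens]

theorem meanDens_eq_integral (hμ : Integrable dens μ) : meanDens μ = ∫ a, dens a ∂μ := by
  rw [meanDens, meanDensOf_eq_integral, meanDensOf_eq_integral,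
    ← integral_add (integrable_densOf hμ 1) (integrable_densOf hμ (-1))]
  simp only [densOf_add_densOf]

theorem meanDens_nonneg (hμ : Integrable dens μ) : 0 ≤ meanDens μ := by
  rw [meanDens_eq_integral hμ]
  exact integral_nonneg dens_nonneg

end CellLaw

section Monokinetic

variable {μ : Measure Cell} [IsFiniteMeasure μ]

/-- A law is monokinetic if all its mass sits at one density, which then is the mean density when
the total mass is one; the direction remains random. -/
def IsMonokinetic (μ : Measure Cell) : Prop := ∀ᵐ a ∂μ, a.2 = (meanDens μ).toNNReal

theorem IsMonokinetic.component_eq (h : IsMonokinetic μ) (z : ℤˣ) :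
    component μ z = ENNReal.ofReal (prob μ z) • Measure.dirac (meanDens μ).toNNReal := by
  have hmap : component μ z = (μ.restrict (Prod.fst ⁻¹' {z})).map fun _ => (meanDens μ).toNNReal :=
    Measure.map_congr (ae_restrict_of_ae h)
  rw [hmap, Measure.map_const, prob_eq_measureReal, ofReal_measureReal, Measure.restrict_apply_univ]

theorem IsMonokinetic.integral_eq_sum (h : IsMonokinetic μ) (φ : Cell → ℝ) :
    ∫ a, φ a ∂μ = ∑ z, prob μ z * φ (z, (meanDens μ).toNNReal) := by
  rw [← integral_fst_eq_sum_prob μ fun z => φ (z, (meanDens μ).toNNReal)]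
  exact integral_congr_ae (h.mono fun a ha => congrArg (fun ρ => φ (a.1, ρ)) ha)

theorem IsMonokinetic.meanDensOf_eq (h : IsMonokinetic μ) (hμ : Integrable dens μ) (z : ℤˣ) :
    meanDensOf μ z = prob μ z * meanDens μ := by
  simp only [meanDensOf_eq_integral, h.integral_eq_sum, densOf, dens, mul_ite, mul_zero,
    Finset.sum_ite_eq', Finset.mem_univ, if_true, Real.coe_toNNReal _ (meanDens_nonneg hμ)]

theorem IsMonokinetic.meanDens_mul_velocity (h : IsMonokinetic μ) (hμ : Integrable dens μ) :
    meanDens μ * velocity μ = meanDensOf μ 1 - meanDensOf μ (-1) := by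
  rw [h.meanDensOf_eq hμ, h.meanDensOf_eq hμ, velocity]
  ring

end Monokinetic

section TestFunctions

variable {ψ : ℤˣ → ℝ → ℝ}

theorem IsTest.continuous (hψ : IsTest ψ) : Continuous fun a : Cell => ψ a.1 (dens a) :=
  continuous_cell fun z => (hψ.1 z).continuous.comp NNReal.continuous_coe

theorem IsTest.continuous_deriv (hψ : IsTest ψ) :
    Continuous fun a : Cell => deriv (ψ a.1) (dens a) :=
  continuous_cell fun z => ((hψ.1 z).continuous_deriv le_rfl).comp NNReal.continuous_coe

theorem IsTest.exists_abs_le (hψ : IsTest ψ) :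
    ∃ C, ∀ a : Cell, |ψ a.1 (dens a)| ≤ C * (1 + dens a) := by
  obtain ⟨hdiff, C, hC⟩ := hψ
  refine ⟨∑ z, |ψ z 0| + C, fun a => ?_⟩
  have hzero : |ψ a.1 0| ≤ ∑ z, |ψ z 0| :=
    Finset.single_le_sum (f := fun z => |ψ z 0|) (fun z _ => abs_nonneg _) (Finset.mem_univ a.1)
  have hmean : |ψ a.1 (dens a) - ψ a.1 0| ≤ C * dens a := by
    simpa [abs_of_nonneg (dens_nonneg a)] using
      convex_univ.norm_image_sub_le_of_norm_deriv_le
        (fun r _ => (hdiff a.1).differentiable one_ne_zero r) (fun r _ => hC a.1 r)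
        (Set.mem_univ 0) (Set.mem_univ (dens a))
  have htri := abs_sub_abs_le_abs_sub (ψ a.1 (dens a)) (ψ a.1 0)
  have hsum := mul_nonneg ((abs_nonneg _).trans hzero) (dens_nonneg a)
  linarith [(abs_nonneg _).trans (hC a.1 0)]

/-- The jump of a one-cell test function at a switch of the direction. -/
def switchJump (ψ : ℤˣ → ℝ → ℝ) (a : Cell) : ℝ := ψ (-a.1) (dens a) - ψ a.1 (dens a)

theorem IsTest.continuous_switchJump (hψ : IsTest ψ) : Continuous (switchJump ψ) :=
  continuous_cell fun z => ((hψ.1 (-z)).continuous.sub (hψ.1 z).continuous).comp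
    NNReal.continuous_coe

theorem IsTest.exists_abs_switchJump_le (hψ : IsTest ψ) :
    ∃ C, ∀ a, |switchJump ψ a| ≤ C * (1 + dens a) := by
  obtain ⟨C, hC⟩ := hψ.exists_abs_le
  refine ⟨2 * C, fun a => (abs_sub _ _).trans ?_⟩
  linarith [hC a, show |ψ (-a.1) (dens a)| ≤ C * (1 + dens a) from hC (-a.1, a.2)]

end TestFunctions

section KineticEquation

variable {N : ℕ}

theorem integral_marginal (μ : Measure (Config N)) (j : ZMod N) {φ : Cell → ℝ}
    (hφ : Measurable φ) : ∫ a, φ a ∂(marginal μ j) = ∫ s, φ (s j) ∂μ :=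
  integral_map (measurable_pi_apply j).aemeasurable hφ.aestronglyMeasurable

instance isProbabilityMeasure_marginal (μ : Measure (Config N)) [IsProbabilityMeasure μ]
    (j : ZMod N) : IsProbabilityMeasure (marginal μ j) :=
  Measure.isProbabilityMeasure_map (measurable_pi_apply j).aemeasurable

theorem flux_sub_flux (s : Config N) (j : ZMod N) :
    flux s j - flux s (j - 1)
      = dens (s j) - (densOf 1 (s (j - 1)) + densOf (-1) (s (j + 1))) := by
  have hpos : ∀ a : Cell, dens a * max (dir a) 0 = densOf 1 a := fun a => by
    rcases Int.units_eq_one_or a.1 with h | h <;> simp [densOf, dir, h]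
  have hneg : ∀ a : Cell, dens a * min (dir a) 0 = -densOf (-1) a := fun a => by
    rcases Int.units_eq_one_or a.1 with h | h <;> simp [densOf, dir, h]
  simp only [flux, hpos, hneg, sub_add_cancel]
  linear_combination densOf_add_densOf (s j)

/-- The mean flow into cell `j` from its two neighbours. -/
def inflow (g : ZMod N → Measure Cell) (j : ZMod N) : ℝ :=
  meanDensOf (g (j - 1)) 1 + meanDensOf (g (j + 1)) (-1)

/-- The transport part of the kinetic equation of cell `j` for the one-cell laws `g`: the density
of the cell grows by the inflow and decays by the outflow, which is the density itself. -/
def meanTransport (g : ZMod N → Measure Cell) (j : ZMod N) (ψ : ℤˣ → ℝ → ℝ) : ℝ :=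
  inflow g j * ∫ a, deriv (ψ a.1) (dens a) ∂(g j) - ∫ a, dens a * deriv (ψ a.1) (dens a) ∂(g j)

theorem integrable_rate_mul_switchJump {μ : Measure (Config N)} {r : Config N → ℝ} {j : ZMod N}
    (hr : Integrable (fun s => r s * (1 + dens (s j))) μ) {ψ : ℤˣ → ℝ → ℝ} (hψ : IsTest ψ) :
    Integrable (fun s => r s * switchJump ψ (s j)) μ := by
  obtain ⟨C, hC⟩ := hψ.exists_abs_switchJump_le
  have hpos : ∀ a : Cell, 0 < 1 + dens a := fun a => by linarith [dens_nonneg a]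
  have hmeas : Measurable fun a => switchJump ψ a / (1 + dens a) :=
    hψ.continuous_switchJump.measurable.div (measurable_dens.const_add 1)
  refine (hr.mul_bdd (c := C) (hmeas.comp (measurable_pi_apply j)).aestronglyMeasurable
    (Eventually.of_forall fun s => ?_)).congr (Eventually.of_forall fun s => ?_)
  · rw [Function.comp_apply, Real.norm_eq_abs, abs_div, abs_of_pos (hpos _), div_le_iff₀ (hpos _)]
    exact hC _
  · have := (hpos (s j)).ne'
    simp only [Function.comp_apply]
    field_simp

variable [NeZero N] {γ : ZMod N → Config N → ℝ}

/-- The switching part of the kinetic equation of cell `j` for the one-cell laws `g`. -/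
def meanSwitching (γ : ZMod N → Config N → ℝ) (g : ZMod N → Measure Cell) (j : ZMod N)
    (ψ : ℤˣ → ℝ → ℝ) : ℝ :=
  ∫ a, effRate γ g j a.1 a.2 * switchJump ψ a ∂(g j)

theorem effRate_nonneg (hγ : ∀ j s, 0 ≤ γ j s) (g : ZMod N → Measure Cell) (j : ZMod N) (z : ℤˣ)
    (ρ : ℝ≥0) : 0 ≤ effRate γ g j z ρ :=
  integral_nonneg fun _ => hγ _ _

theorem generator_oneCell (γ : ZMod N → Config N → ℝ) (j : ZMod N) (ψ : ℤˣ → ℝ → ℝ)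
    (s : Config N) :
    generator γ (oneCell j ψ) s
      = -((flux s j - flux s (j - 1)) * deriv (ψ (s j).1) (dens (s j)))
        + (1 / (N : ℝ)) * (γ j s * switchJump ψ (s j)) := by
  rw [generator, Finset.sum_eq_single j, Finset.sum_eq_single j]
  · simp [partialDens, oneCell, evalAt, switch, switchJump, dens]
  · intro i _ hij
    simp [evalAt, oneCell, switch, Function.update_of_ne hij.symm]
  · simp
  · intro i _ hij
    simp [partialDens, oneCell, Function.update_of_ne hij.symm]
  · simp

section ProductOfMarginals

variable {g : ZMod N → Measure Cell} [∀ i, IsProbabilityMeasure (g i)] {ψ : ℤˣ → ℝ → ℝ}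

theorem measurable_effRate (hγ : ∀ j, Measurable (γ j)) (j : ZMod N) :
    Measurable fun a : Cell => effRate γ g j a.1 a.2 :=
  (((hγ j).comp measurable_update').stronglyMeasurable.integral_prod_left'
    (μ := Measure.pi g)).measurable

theorem integral_rate_mul (j : ZMod N) {κ : Cell → ℝ}
    (hint : Integrable (fun s => γ j s * κ (s j)) (Measure.pi g)) :
    ∫ s, γ j s * κ (s j) ∂(Measure.pi g) = ∫ a, effRate γ g j a.1 a.2 * κ a ∂(g j) := by
  have hupdate : Measurable fun p : Config N × Cell => Function.update p.1 j p.2 :=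
    measurable_update'
  rw [← map_update_pi g j] at hint
  conv_lhs => rw [← map_update_pi g j]
  rw [integral_map hupdate.aemeasurable hint.aestronglyMeasurable]
  refine (integral_prod_symm _ (hint.comp_measurable hupdate)).trans ?_
  simp only [Function.comp_apply, Function.update_self, integral_mul_const, effRate]

theorem integrable_eval_mul_deriv {φ : Cell → ℝ} (i j : ZMod N) (hφ : Integrable φ (g i))
    (hψ : IsTest ψ) :
    Integrable (fun s => φ (s i) * deriv (ψ (s j).1) (dens (s j))) (Measure.pi g) := by
  obtain ⟨C, hC⟩ := hψ.2
  exact (integrable_comp_eval (μ := g) hφ).mul_bdd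
    (hψ.continuous_deriv.measurable.comp (measurable_pi_apply j)).aestronglyMeasurable
    (Eventually.of_forall fun s => hC _ _)

theorem integral_densOf_mul_deriv {i j : ZMod N} (hij : i ≠ j) (z : ℤˣ) (hψ : IsTest ψ) :
    ∫ s, densOf z (s i) * deriv (ψ (s j).1) (dens (s j)) ∂(Measure.pi g)
      = meanDensOf (g i) z * ∫ a, deriv (ψ a.1) (dens a) ∂(g j) := by
  rw [meanDensOf_eq_integral]
  exact integral_eval_mul_eval_pi g hij (measurable_densOf z) hψ.continuous_deriv.measurable

theorem integral_generator_oneCell (hN : N ≠ 1) (hg : ∀ i, Integrable dens (g i)) {j : ZMod N}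
    (hγ : Integrable (fun s => γ j s * (1 + dens (s j))) (Measure.pi g)) (hψ : IsTest ψ) :
    ∫ s, generator γ (oneCell j ψ) s ∂(Measure.pi g)
      = meanTransport g j ψ + (1 / (N : ℝ)) * meanSwitching γ g j ψ := by
  have : Fact (1 < N) := ⟨by have := NeZero.ne N; omega⟩
  set W : Config N → ℝ := fun s => deriv (ψ (s j).1) (dens (s j))
  have hin : ∀ z i, Integrable (fun s => densOf z (s i) * W s) (Measure.pi g) := fun z i =>
    integrable_eval_mul_deriv i j (integrable_densOf (hg i) z) hψ
  have hout : Integrable (fun s => dens (s j) * W s) (Measure.pi g) :=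
    integrable_eval_mul_deriv j j (hg j) hψ
  have hinflow : Integrable
      (fun s => densOf 1 (s (j - 1)) * W s + densOf (-1) (s (j + 1)) * W s) (Measure.pi g) :=
    (hin _ _).add (hin _ _)
  have hnet : Integrable (fun s => densOf 1 (s (j - 1)) * W s + densOf (-1) (s (j + 1)) * W s
      - dens (s j) * W s) (Measure.pi g) := hinflow.sub hout
  have hswitch := integrable_rate_mul_switchJump hγ hψ
  have hself : ∫ s, dens (s j) * W s ∂(Measure.pi g)
      = ∫ a, dens a * deriv (ψ a.1) (dens a) ∂(g j) :=
    integral_comp_eval (μ := g)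
      (measurable_dens.mul hψ.continuous_deriv.measurable).aestronglyMeasurable
  have hgen : ∀ s, generator γ (oneCell j ψ) s
      = densOf 1 (s (j - 1)) * W s + densOf (-1) (s (j + 1)) * W s - dens (s j) * W s
        + (1 / (N : ℝ)) * (γ j s * switchJump ψ (s j)) := fun s => by
    rw [generator_oneCell, flux_sub_flux]
    ring
  simp only [hgen]
  rw [integral_add hnet (hswitch.const_mul _), integral_sub hinflow hout,
    integral_add (hin _ _) (hin _ _), integral_densOf_mul_deriv (by simp) _ hψ,
    integral_densOf_mul_deriv (by simp) _ hψ, hself, integral_const_mul,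
    integral_rate_mul j hswitch, meanTransport, inflow, add_mul, meanSwitching]

end ProductOfMarginals

variable {F : ℝ → Measure (Config N)} {ψ : ℤˣ → ℝ → ℝ} {t : ℝ}

theorem SolvesMasterEquation.integrable_dens_marginal (hF : SolvesMasterEquation γ F)
    (ht : 0 < t) (j : ZMod N) : Integrable dens (marginal (F t) j) :=
  (integrable_map_measure measurable_dens.aestronglyMeasurable
    (measurable_pi_apply j).aemeasurable).2 (hF.integrable_dens t ht j)

theorem SolvesMasterEquation.hasDerivAt_integral_marginal (hF : SolvesMasterEquation γ F)
    (hchaos : PropagationOfChaos F) (hN : N ≠ 1) (hψ : IsTest ψ) (j : ZMod N) (ht : 0 < t) :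
    HasDerivAt (fun τ => ∫ a, ψ a.1 (dens a) ∂(marginal (F τ) j))
      (meanTransport (marginal (F t)) j ψ
        + (1 / (N : ℝ)) * meanSwitching γ (marginal (F t)) j ψ) t := by
  have := hF.isProbabilityMeasure t ht
  have hrate := hF.integrable_rate t ht j
  have hweak := hF.weak_form t ht j ψ hψ
  rw [hchaos t ht] at hrate hweak
  rw [integral_generator_oneCell hN (hF.integrable_dens_marginal ht) hrate hψ] at hweak
  simp only [integral_marginal _ _ hψ.continuous.measurable]
  exact hweak

end KineticEquation

section Rescaled

variable {F : (N : ℕ+) → ℝ → Measure (Config N)} {N : ℕ+} {γ : ZMod N → Config N → ℝ} {t : ℝ}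

theorem SolvesMasterEquation.isProbabilityMeasure_rescaled (hF : SolvesMasterEquation γ (F N))
    (ht : 0 < t) (j : ZMod N) : IsProbabilityMeasure (rescaled F N j t) :=
  have := hF.isProbabilityMeasure _ (mul_pos (pnat_cast_pos N) ht)
  isProbabilityMeasure_marginal _ j

theorem SolvesMasterEquation.integrable_dens_rescaled (hF : SolvesMasterEquation γ (F N))
    (ht : 0 < t) (j : ZMod N) : Integrable dens (rescaled F N j t) :=
  hF.integrable_dens_marginal (mul_pos (pnat_cast_pos N) ht) j

theorem SolvesMasterEquation.hasDerivAt_integral_rescaled (hF : SolvesMasterEquation γ (F N))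
    (hchaos : PropagationOfChaos (F N)) (hN : 1 < N) {ψ : ℤˣ → ℝ → ℝ} (hψ : IsTest ψ)
    (j : ZMod N) (ht : 0 < t) :
    HasDerivAt (fun τ => ∫ a, ψ a.1 (dens a) ∂(rescaled F N j τ))
      ((N : ℝ) * meanTransport (fun i => rescaled F N i t) j ψ
        + meanSwitching γ (fun i => rescaled F N i t) j ψ) t := by
  have hN' : (N : ℕ) ≠ 1 := fun h => hN.ne' (PNat.coe_eq_one_iff.1 h)
  have hkin := hF.hasDerivAt_integral_marginal hchaos hN' hψ j (mul_pos (pnat_cast_pos N) ht)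
  refine (hkin.comp t ((hasDerivAt_id t).const_mul (N : ℝ))).congr_deriv ?_
  have := (pnat_cast_pos N).ne'
  simp only [rescaled]
  field_simp

end Rescaled

section ProfileTendsto

variable {g : Profile} {f : ℝ → ℝ → Measure Cell} {t : ℝ}

theorem ProfileTendsto.gridTendsto_integral (h : ProfileTendsto g f) {φ : Cell → ℝ}
    (hφ : Continuous φ) {C : ℝ} (hC : ∀ a, |φ a| ≤ C * (1 + dens a)) :
    GridTendsto (fun N j t => ∫ a, φ a ∂(g N j t)) fun x t => ∫ a, φ a ∂(f x t) :=
  h.tendsto (fun z ρ => φ (z, ρ)) (fun z => hφ.comp (Continuous.prodMk_right z))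
    ⟨C, fun z ρ => hC (z, ρ)⟩

theorem ProfileTendsto.isFiniteMeasure (h : ProfileTendsto g f) (x : ℝ) (ht : 0 < t) :
    IsFiniteMeasure (f x t) :=
  isFiniteMeasure_of_integrable_one_add_dens (h.integrable x t ht)

theorem ProfileTendsto.integrable_dens (h : ProfileTendsto g f) (x : ℝ) (ht : 0 < t) :
    Integrable dens (f x t) :=
  integrable_dens_of_one_add (h.integrable x t ht)

theorem ProfileTendsto.isProbabilityMeasure (h : ProfileTendsto g f)
    (hg : ∀ N j t, 0 < t → IsProbabilityMeasure (g N j t)) (x : ℝ) (ht : 0 < t) :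
    IsProbabilityMeasure (f x t) := by
  have := h.isFiniteMeasure x ht
  have hmass := h.gridTendsto_integral (φ := fun _ => 1) continuous_const (C := 1)
    (fun a => by simpa using dens_nonneg a) x t ht
  have hone : Tendsto (fun q : ℕ+ × ℤ × ℝ => ∫ _, (1 : ℝ) ∂(g q.1 (q.2.1 : ZMod q.1) q.2.2))
      (hydroFilter x t) (𝓝 1) := by
    refine tendsto_const_nhds.congr' ?_
    filter_upwards [eventually_time_pos x ht] with q hq
    have := hg q.1 q.2.1 q.2.2 hq
    simp
  have hreal : (f x t).real Set.univ = 1 := by simpa using tendsto_nhds_unique hmass hone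
  exact isProbabilityMeasure_iff_real.2 hreal

theorem ProfileTendsto.gridTendsto_meanDensOf (h : ProfileTendsto g f) (z : ℤˣ) :
    GridTendsto (fun N j t => meanDensOf (g N j t) z) fun x t => meanDensOf (f x t) z := by
  simp only [meanDensOf_eq_integral]
  exact h.gridTendsto_integral (continuous_densOf z) (C := 1)
    fun a => by linarith [abs_densOf_le z a]

theorem ProfileTendsto.gridTendsto_meanDens (h : ProfileTendsto g f) :
    GridTendsto (fun N j t => meanDens (g N j t)) fun x t => meanDens (f x t) := fun x t ht =>
  (h.gridTendsto_meanDensOf 1 x t ht).add (h.gridTendsto_meanDensOf (-1) x t ht)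

theorem ProfileTendsto.gridTendsto_inflow (h : ProfileTendsto g f) :
    GridTendsto (fun N j t => inflow (fun i => g N i t) j) fun x t => meanDens (f x t) := by
  intro x t ht
  simpa [inflow, meanDens, sub_eq_add_neg] using
    ((h.gridTendsto_meanDensOf 1).comp_shift (-1) x t ht).add
      ((h.gridTendsto_meanDensOf (-1)).comp_shift 1 x t ht)

theorem ProfileTendsto.gridTendsto_meanTransport (h : ProfileTendsto g f) {ψ : ℤˣ → ℝ → ℝ}
    (hψ : IsTest ψ) :
    GridTendsto (fun N j t => meanTransport (fun i => g N i t) j ψ) fun x t =>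
      meanDens (f x t) * ∫ a, deriv (ψ a.1) (dens a) ∂(f x t)
        - ∫ a, dens a * deriv (ψ a.1) (dens a) ∂(f x t) := by
  obtain ⟨C, hC⟩ := hψ.2
  have hC0 : 0 ≤ C := (abs_nonneg _).trans (hC 1 0)
  have hderiv := h.gridTendsto_integral hψ.continuous_deriv (C := C) fun a =>
    (hC a.1 _).trans (by nlinarith [dens_nonneg a])
  have hout := h.gridTendsto_integral (φ := fun a => dens a * deriv (ψ a.1) (dens a))
    (continuous_dens.mul hψ.continuous_deriv) (C := C) fun a => by
      rw [abs_mul, abs_of_nonneg (dens_nonneg a)]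
      nlinarith [mul_le_mul_of_nonneg_left (hC a.1 (dens a)) (dens_nonneg a)]
  exact fun x t ht =>
    ((h.gridTendsto_inflow x t ht).mul (hderiv x t ht)).sub (hout x t ht)

theorem gridTendsto_mul_inflow_sub {D : ℤˣ → ℝ → ℝ → ℝ}
    (hD : ∀ z, GridTendsto (fun N j t =>
      (meanDensOf (g N (j + 1) t) z - meanDensOf (g N j t) z) / (1 / (N : ℝ))) (D z)) :
    GridTendsto (fun N j t => (N : ℝ) * (inflow (fun i => g N i t) j - meanDens (g N j t)))
      fun x t => D (-1) x t - D 1 x t := by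
  intro x t ht
  refine ((hD (-1) x t ht).sub ((hD 1).comp_shift (-1) x t ht)).congr fun q => ?_
  simp only [inflow, meanDens, Int.cast_neg, Int.cast_one, neg_add_cancel_right, sub_eq_add_neg]
  field_simp
  ring

end ProfileTendsto

section Concentration

variable {μ : Measure Cell} [IsFiniteMeasure μ]

theorem deriv_log_one_add_sq (c r : ℝ) :
    deriv (fun r => Real.log (1 + (r - c) ^ 2)) r = 2 * (r - c) / (1 + (r - c) ^ 2) := by
  have hpos : 1 + (r - c) ^ 2 ≠ 0 := by positivity
  simpa using (((((hasDerivAt_id r).sub_const c).pow 2).const_add 1).log hpos).deriv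

theorem isTest_log_one_add_sq (c : ℝ) : IsTest fun _ r => Real.log (1 + (r - c) ^ 2) := by
  refine ⟨fun _ => ContDiff.log (by fun_prop) fun r => by positivity, 1, fun _ r => ?_⟩
  have hpos : 0 < 1 + (r - c) ^ 2 := by positivity
  rw [deriv_log_one_add_sq, abs_div, abs_of_pos hpos, div_le_one hpos, abs_le]
  constructor <;> nlinarith [sq_nonneg (r - c - 1), sq_nonneg (r - c + 1)]

theorem isMonokinetic_of_forall_isTest (hμ : Integrable dens μ)
    (h : ∀ φ : ℝ → ℝ, IsTest (fun _ => φ) →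
      meanDens μ * ∫ a, deriv φ (dens a) ∂μ = ∫ a, dens a * deriv φ (dens a) ∂μ) :
    IsMonokinetic μ := by
  set c := meanDens μ
  set φ : ℝ → ℝ := fun r => Real.log (1 + (r - c) ^ 2)
  have hφ : IsTest fun _ => φ := isTest_log_one_add_sq c
  have hbal := h φ hφ
  obtain ⟨C, hC⟩ := hφ.2
  have hmeas : AEStronglyMeasurable (fun a : Cell => deriv φ (dens a)) μ :=
    hφ.continuous_deriv.aestronglyMeasurable
  have hbdd : ∀ᵐ a ∂μ, ‖deriv φ (dens a)‖ ≤ C := Eventually.of_forall fun a => hC 1 _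
  have hint : Integrable (fun a : Cell => deriv φ (dens a)) μ := .of_bound hmeas C hbdd
  have hint' : Integrable (fun a => dens a * deriv φ (dens a)) μ := hμ.mul_bdd hmeas hbdd
  have hsq : ∀ r, r * deriv φ r - c * deriv φ r = 2 * (r - c) ^ 2 / (1 + (r - c) ^ 2) := fun r => by
    rw [deriv_log_one_add_sq]
    ring
  have hzero : ∫ a, 2 * (dens a - c) ^ 2 / (1 + (dens a - c) ^ 2) ∂μ = 0 := by
    simp only [← hsq]
    rw [integral_sub hint' (hint.const_mul c), integral_const_mul, hbal, sub_self]
  have hsq_int : Integrable (fun a => 2 * (dens a - c) ^ 2 / (1 + (dens a - c) ^ 2)) μ :=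
    (hint'.sub (hint.const_mul c)).congr (Eventually.of_forall fun a => hsq (dens a))
  rw [integral_eq_zero_iff_of_nonneg (fun a => by positivity) hsq_int] at hzero
  filter_upwards [hzero] with a ha
  have hac : dens a = c := by
    have hpos : 1 + (dens a - c) ^ 2 ≠ 0 := by positivity
    simpa [hpos, sub_eq_zero] using ha
  rw [show meanDens μ = dens a from hac.symm, dens, Real.toNNReal_coe]

end Concentration

section HydrodynamicLimit

variable {γ : (N : ℕ+) → ZMod N → Config N → ℝ} {F : (N : ℕ+) → ℝ → Measure (Config N)}
  {f : ℝ → ℝ → Measure Cell} {t : ℝ}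

theorem isMonokinetic_of_profileTendsto_rescaled (hF : ∀ N, SolvesMasterEquation (γ N) (F N))
    (hchaos : ∀ N, PropagationOfChaos (F N)) (hf : ProfileTendsto (rescaled F) f) (x : ℝ)
    (ht : 0 < t) : IsMonokinetic (f x t) := by
  have := hf.isFiniteMeasure x ht
  refine isMonokinetic_of_forall_isTest (hf.integrable_dens x ht) fun φ hφ => ?_
  obtain ⟨C, hC⟩ := hφ.exists_abs_le
  refine sub_eq_zero.1 ((hf.gridTendsto_integral hφ.continuous hC).eq_zero_of_hasDerivAt_mul
    (hf.gridTendsto_meanTransport hφ) ?_ x ht)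
  filter_upwards [eventually_gt_atTop 1] with N hN j t ht
  simpa [meanSwitching, switchJump] using
    (hF N).hasDerivAt_integral_rescaled (hchaos N) hN hφ j ht

theorem isTest_id : IsTest fun _ r => r :=
  ⟨fun _ => contDiff_id, 1, fun _ _ => by simp⟩

theorem hasDerivAt_meanDens_of_profileTendsto_rescaled
    (hF : ∀ N, SolvesMasterEquation (γ N) (F N)) (hchaos : ∀ N, PropagationOfChaos (F N))
    (hf : ProfileTendsto (rescaled F) f) {D : ℤˣ → ℝ → ℝ → ℝ}
    (hD : ∀ z, GridTendsto (fun N j t => (meanDensOf (rescaled F N (j + 1) t) z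
      - meanDensOf (rescaled F N j t) z) / (1 / (N : ℝ))) (D z)) (x : ℝ) (ht : 0 < t) :
    HasDerivAt (fun τ => meanDens (f x τ)) (D (-1) x t - D 1 x t) t := by
  refine hf.gridTendsto_meanDens.hasDerivAt_time (gridTendsto_mul_inflow_sub hD) ?_ x ht
  filter_upwards [eventually_gt_atTop 1] with N hN j t ht
  have := (hF N).isProbabilityMeasure_rescaled ht j
  have hmean : ∀ {τ}, 0 < τ → meanDens (rescaled F N j τ) = ∫ a, dens a ∂(rescaled F N j τ) :=
    fun hτ => meanDens_eq_integral ((hF N).integrable_dens_rescaled hτ j)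
  have hkin := (hF N).hasDerivAt_integral_rescaled (hchaos N) hN isTest_id j ht
  simp only [meanTransport, meanSwitching, switchJump, deriv_id'', mul_one, integral_const,
    probReal_univ, smul_eq_mul, sub_self, mul_zero, add_zero, ← hmean ht] at hkin
  exact hkin.congr_of_eventuallyEq ((lt_mem_nhds ht).mono fun τ hτ => hmean hτ)

variable {γbar : ℝ → ℤˣ → ℝ≥0 → ℝ → ℝ} {g : Profile}

theorem limitRate_nonneg (hγ : ∀ N j s, 0 ≤ γ N j s) (hγbar : RateTendsto γ g γbar)
    (f : ℝ → ℝ → Measure Cell) (z : ℤˣ) (x : ℝ) (ht : 0 < t) : 0 ≤ limitRate γbar f z x t :=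
  ge_of_tendsto (hγbar x t z _ ht)
    (Eventually.of_forall fun q => effRate_nonneg (hγ q.1.1) _ _ _ _)

theorem RateTendsto.tendsto_cell (hγbar : RateTendsto γ g γbar) (x : ℝ) (ht : 0 < t) (a : Cell) :
    Tendsto (fun p : (ℕ+ × ℤ × ℝ) × Cell =>
        effRate (γ p.1.1) (fun i => g p.1.1 i p.1.2.2) (p.1.2.1 : ZMod p.1.1) p.2.1 p.2.2)
      (hydroFilter x t ×ˢ 𝓝 a) (𝓝 (γbar x a.1 a.2 t)) := by
  have hnhds : 𝓝 a = (𝓝 a.2).map (Prod.mk a.1) := by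
    rw [← a.eta, nhds_prod_eq, nhds_discrete, pure_prod]
  rw [hnhds, prod_map_right, tendsto_map'_iff]
  exact hγbar x t a.1 a.2 ht

theorem MeanFieldLimit.gridTendsto_integral_effRate_mul (hγ_meas : ∀ N j, Measurable (γ N j))
    (hγ_nonneg : ∀ N j s, 0 ≤ γ N j s)
    (hg : ∀ N j t, 0 < t → IsProbabilityMeasure (g N j t))
    (hg_int : ∀ N j t, 0 < t → Integrable dens (g N j t)) (hf : ProfileTendsto g f)
    (hγbar : MeanFieldLimit γ g γbar) {κ : Cell → ℝ} (hκ : Continuous κ) {K : ℝ}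
    (hK : ∀ a, |κ a| ≤ K) :
    GridTendsto
      (fun N j t => ∫ a, effRate (γ N) (fun i => g N i t) j a.1 a.2 * κ a ∂(g N j t))
      fun x t => ∫ a, γbar x a.1 a.2 t * κ a ∂(f x t) := by
  intro x t ht
  obtain ⟨C, hC⟩ := hγbar.growth x t ht
  have hpos := eventually_time_pos x ht
  refine tendsto_integral_of_tendsto_prod_nhds (w := fun a => 1 + dens a) (C := C * K)
    (continuous_const.add continuous_dens) (fun a => by linarith [dens_nonneg a])
    isCompact_one_add_dens_le (hf.integrable x t ht) (hpos.mono fun q hq => ?_)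
    (fun φ hφ ⟨B, hB⟩ => hf.gridTendsto_integral hφ hB x t ht) (hpos.mono fun q hq => ?_)
    (hC.mono fun q hq a => ?_) fun a =>
      (hγbar.tendsto.tendsto_cell x ht a).mul ((hκ.tendsto a).comp tendsto_snd)
  · have := hg q.1 q.2.1 q.2.2 hq
    exact integrable_one_add_dens (hg_int _ _ _ hq)
  · have := fun i => hg q.1 i q.2.2 hq
    exact ((measurable_effRate (hγ_meas q.1) _).mul hκ.measurable).aestronglyMeasurable
  · have heff := effRate_nonneg (hγ_nonneg q.1) (fun i => g q.1 i q.2.2) q.2.1 a.1 a.2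
    rw [abs_mul, abs_of_nonneg heff, mul_right_comm]
    exact mul_le_mul (hq a.1 a.2) (hK a) (abs_nonneg _) (heff.trans (hq a.1 a.2))

theorem isTest_direction : IsTest fun z _ => ((z : ℤ) : ℝ) :=
  ⟨fun _ => contDiff_const, 0, fun _ _ => by simp⟩

theorem continuous_dir : Continuous dir := isTest_direction.continuous

theorem sum_prob_mul_limitRate_eq (hγ : ∀ N j s, 0 ≤ γ N j s) (hγbar : RateTendsto γ g γbar)
    (x : ℝ) (ht : 0 < t) [IsProbabilityMeasure (f x t)] :
    ∑ z : ℤˣ, prob (f x t) z * (limitRate γbar f z x t * (-2 * ((z : ℤ) : ℝ)))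
      = totalRate γbar f x t * (collVelocity γbar f x t - velocity (f x t)) := by
  have hsum := sum_prob (f x t)
  have hpos := limitRate_nonneg hγ hγbar f 1 x ht
  have hneg := limitRate_nonneg hγ hγbar f (-1) x ht
  rw [sum_intUnits, totalRate, collVelocity, velocity]
  push_cast
  rcases (add_nonneg hneg hpos).eq_or_lt with hzero | htot
  · rw [show limitRate γbar f 1 x t = 0 by linarith, show limitRate γbar f (-1) x t = 0 by linarith]
    simp
  · rw [mul_sub, mul_div_cancel₀ _ htot.ne']
    linear_combination (limitRate γbar f (-1) x t - limitRate γbar f 1 x t) * hsum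

theorem hasDerivAt_velocity_of_profileTendsto_rescaled (hγ_meas : ∀ N j, Measurable (γ N j))
    (hγ_nonneg : ∀ N j s, 0 ≤ γ N j s) (hF : ∀ N, SolvesMasterEquation (γ N) (F N))
    (hchaos : ∀ N, PropagationOfChaos (F N)) (hf : ProfileTendsto (rescaled F) f)
    (hγbar : MeanFieldLimit γ (rescaled F) γbar) (x : ℝ) (ht : 0 < t) :
    HasDerivAt (fun τ => velocity (f x τ))
      (totalRate γbar f x t * (collVelocity γbar f x t - velocity (f x t))) t := by
  have hprob : ∀ N j t, 0 < t → IsProbabilityMeasure (rescaled F N j t) :=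
    fun N j t ht => (hF N).isProbabilityMeasure_rescaled ht j
  have hdir := hf.gridTendsto_integral continuous_dir (C := 1) fun a => by
    simpa [abs_dir] using dens_nonneg a
  have hswitch := hγbar.gridTendsto_integral_effRate_mul hγ_meas hγ_nonneg hprob
    (fun N j t ht => (hF N).integrable_dens_rescaled ht j) hf (κ := fun a => -2 * dir a) (K := 2)
    (continuous_const.mul continuous_dir) fun a => by simp [abs_mul, abs_dir]
  have hlim := hdir.hasDerivAt_time hswitch
    ((eventually_gt_atTop 1).mono fun N hN j t ht => ?_) x ht
  · have := hf.isFiniteMeasure x ht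
    have := hf.isProbabilityMeasure hprob x ht
    rw [← sum_prob_mul_limitRate_eq hγ_nonneg hγbar.tendsto x ht]
    rw [(isMonokinetic_of_profileTendsto_rescaled hF hchaos hf x ht).integral_eq_sum] at hlim
    refine hlim.congr_of_eventuallyEq ((lt_mem_nhds ht).mono fun τ hτ => ?_)
    have := hf.isFiniteMeasure x hτ
    exact velocity_eq_integral _
  · have hjump : switchJump (fun z _ => ((z : ℤ) : ℝ)) = fun a => -2 * dir a := by
      funext a
      simp only [switchJump, dir, Units.val_neg, Int.cast_neg]
      ring
    simpa [dir, meanTransport, meanSwitching, hjump] using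
      (hF N).hasDerivAt_integral_rescaled (hchaos N) hN isTest_direction j ht

end HydrodynamicLimit

section DiracProfile

variable {f : ℝ → ℝ → Measure Cell} {N : ℕ+} {t : ℝ}

theorem integral_diracProfile (f : ℝ → ℝ → Measure Cell) (N : ℕ+) (i : ZMod N) (t : ℝ)
    (φ : Cell → ℝ) :
    ∫ a, φ a ∂(diracProfile f N i t)
      = ∑ z, prob (f ((i.val : ℝ) / (N : ℝ)) t) z
          * φ (z, (meanDens (f ((i.val : ℝ) / (N : ℝ)) t)).toNNReal) := by
  rw [diracProfile, integral_finsetSum_measure fun z _ =>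
    (integrable_dirac (by simp)).smul_measure ENNReal.ofReal_ne_top]
  simp only [integral_smul_measure, integral_dirac, ENNReal.toReal_ofReal (prob_nonneg _ _),
    smul_eq_mul]

theorem isProbabilityMeasure_diracProfile (hf : ∀ x, IsProbabilityMeasure (f x t))
    (i : ZMod N) : IsProbabilityMeasure (diracProfile f N i t) := by
  constructor
  simp [diracProfile, ← ENNReal.ofReal_add (prob_nonneg _ _) (prob_nonneg _ _),
    sum_prob]

theorem integrable_dens_diracProfile (f : ℝ → ℝ → Measure Cell) (N : ℕ+) (i : ZMod N) (t : ℝ) :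
    Integrable dens (diracProfile f N i t) :=
  integrable_finsetSum_measure.2 fun _ _ =>
    (integrable_dirac (by simp)).smul_measure ENNReal.ofReal_ne_top

theorem intCast_div_eq_val_div_add (N : ℕ+) (j : ℤ) :
    (j : ℝ) / (N : ℝ) = ((j : ZMod N).val : ℝ) / (N : ℝ) + ((j / (N : ℤ) : ℤ) : ℝ) := by
  have hdiv : (((j : ZMod N).val : ℤ) : ℝ) + (N : ℝ) * ((j / (N : ℤ) : ℤ) : ℝ) = j := by
    rw [ZMod.val_intCast]
    exact_mod_cast Int.emod_add_mul_ediv j N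
  have := (pnat_cast_pos N).ne'
  rw [← hdiv]
  push_cast
  field_simp

theorem GridTendsto.apply_val_div {a : (N : ℕ+) → ZMod N → ℝ → ℝ} {b : ℝ → ℝ → ℝ}
    (h : GridTendsto a b) (ht : 0 < t) (N : ℕ+) (j : ℤ) :
    b (((j : ZMod N).val : ℝ) / (N : ℝ)) t = b ((j : ℝ) / (N : ℝ)) t := by
  rw [intCast_div_eq_val_div_add N j]
  simpa using ((h.periodic ht).int_mul (j / (N : ℤ)) _).symm

theorem ProfileTendsto.diracProfile {g : Profile} (h : ProfileTendsto g f)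
    (hmono : ∀ x t, 0 < t → IsMonokinetic (f x t)) : ProfileTendsto (diracProfile f) f where
  integrable := h.integrable
  tendsto φ hφ hC x t ht := by
    have hgrid := h.tendsto φ hφ hC
    refine ((hgrid.continuousAt x ht).tendsto.comp
      (tendsto_pos_hydroFilter.prodMk_nhds tendsto_time_hydroFilter)).congr' ?_
    filter_upwards [eventually_time_pos x ht] with q hq
    have := h.isFiniteMeasure (((q.2.1 : ZMod q.1).val : ℝ) / (q.1 : ℝ)) hq
    rw [integral_diracProfile f q.1 _ _ fun a => φ a.1 a.2,
      ← (hmono _ _ hq).integral_eq_sum fun a => φ a.1 a.2]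
    exact (hgrid.apply_val_div hq q.1 q.2.1).symm

end DiracProfile

end Sweeping

end

theorem mainTheorem1
    (γ : (N : ℕ+) → ZMod N → Sweeping.Config N → ℝ)
    (hγ_meas : ∀ N j, Measurable (γ N j))
    (hγ_nonneg : ∀ N j s, 0 ≤ γ N j s)
    (F : (N : ℕ+) → ℝ → Measure (Sweeping.Config N))
    (hF : ∀ N, Sweeping.SolvesMasterEquation (γ N) (F N))
    (hchaos : ∀ N, Sweeping.PropagationOfChaos (F N))
    (f : ℝ → ℝ → Measure Sweeping.Cell)
    (hf : Sweeping.SmoothTendsto (Sweeping.rescaled F) f)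
    (γbar : ℝ → ℤˣ → ℝ≥0 → ℝ → ℝ)
    (hγbar : Sweeping.MeanFieldLimit γ (Sweeping.rescaled F) γbar) :
    (∀ x t : ℝ, 0 < t →
      -- the limit law is monokinetic
      (∀ z : ℤˣ, Sweeping.component (f x t) z =
        ENNReal.ofReal (Sweeping.prob (f x t) z) •
          Measure.dirac (Sweeping.meanDens (f x t)).toNNReal) ∧
      -- continuity equation
      DifferentiableAt ℝ (fun y => Sweeping.meanDens (f y t) * Sweeping.velocity (f y t)) x ∧
      HasDerivAt (fun τ => Sweeping.meanDens (f x τ))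
        (-deriv (fun y => Sweeping.meanDens (f y t) * Sweeping.velocity (f y t)) x) t ∧
      -- relaxation of the velocity
      HasDerivAt (fun τ => Sweeping.velocity (f x τ))
        (Sweeping.totalRate γbar f x t *
          (Sweeping.collVelocity γbar f x t - Sweeping.velocity (f x t))) t ∧
      Sweeping.prob (f x t) 1 = (1 + Sweeping.velocity (f x t)) / 2 ∧
      Sweeping.prob (f x t) (-1) = (1 - Sweeping.velocity (f x t)) / 2) ∧
    -- the limiting rates in terms of the monokinetic law
    (Sweeping.MeanFieldStable γ f γbar →
      Sweeping.RateTendsto γ (Sweeping.diracProfile f) γbar) := by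
  have hft := hf.toProfileTendsto
  have hprob : ∀ x t, 0 < t → IsProbabilityMeasure (f x t) := fun x t =>
    hft.isProbabilityMeasure (fun N j t ht => (hF N).isProbabilityMeasure_rescaled ht j) x
  have hmono : ∀ x t, 0 < t → Sweeping.IsMonokinetic (f x t) := fun x t ht =>
    Sweeping.isMonokinetic_of_profileTendsto_rescaled hF hchaos hft x ht
  refine ⟨fun x t ht => ?_, fun hstable => hstable _ (fun N j t ht =>
    ⟨Sweeping.isProbabilityMeasure_diracProfile (fun x => hprob x t ht) j,
      Sweeping.integrable_dens_diracProfile f N j t⟩) (hft.diracProfile hmono)⟩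
  have := hprob x t ht
  have hsum := Sweeping.sum_prob (f x t)
  choose D hD using hf.space_deriv
  have hflux : HasDerivAt (fun y => Sweeping.meanDens (f y t) * Sweeping.velocity (f y t))
      (D 1 x t - D (-1) x t) x := by
    refine (((hft.gridTendsto_meanDensOf 1).hasDerivAt_space (hD 1) x ht).sub
      ((hft.gridTendsto_meanDensOf (-1)).hasDerivAt_space (hD (-1)) x ht)).congr_of_eventuallyEq
      (.of_forall fun y => ?_)
    have := hprob y t ht
    exact (hmono y t ht).meanDens_mul_velocity (hft.integrable_dens y ht)
  refine ⟨(hmono x t ht).component_eq, hflux.differentiableAt, ?_,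
    Sweeping.hasDerivAt_velocity_of_profileTendsto_rescaled hγ_meas hγ_nonneg hF hchaos hft hγbar
      x ht, ?_, ?_⟩
  · rw [hflux.deriv, neg_sub]
    exact Sweeping.hasDerivAt_meanDens_of_profileTendsto_rescaled hF hchaos hft hD x ht
  all_goals rw [Sweeping.velocity]; linarith
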